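/- Let $(W,S)$ be a Coxeter system with $W$ finite and length function $l$. Let $\mathcal{H}$ be the Iwahori–Hecke algebra over $\mathbb{Z}[v,v^{-1}]$ with basis $\{T_w\}_{w\in W}$ and multiplication $T_sT_w=T_{sw}$ if $l(sw)>l(w)$, $T_sT_w=T_{sw}+(v-v^{-1})T_w$ if $l(sw)<l(w)$ ($s\in S$). Let $C'_w=\sum_y v^{l(y)-l(w)}P_{y,w}T_y$ be its Kazhdan–Lusztig basis: $C'_w$ is fixed by the bar involution $\sum a_w(v)T_w\mapsto\sum a_w(v^{-1})T_{w^{-1}}^{-1}$, $P_{y,w}\in\mathbb{Z}[v]$, $P_{w,w}=1$, $P_{y,w}=0$ unless $y\le w$ in the Bruhat–Chevalley order, and $\deg P_{y,w}\le l(w)-l(y)-1$ if $y<w$. For $y<w$ let $\mu(y,w)$ be the coefficient of $v^{l(w)-l(y)-1}$ in $P_{y,w}$; put $\tilde\mu(x,y)=\mu(x,y)$ if $x<y$, $\tilde\mu(x,y)=\mu(y,x)$ if $y<x$, and $\tilde\mu(x,y)=0$ otherwise. Write $y\leftarrow_L w$ if $y=w$; or $y<w$, $\mu(y,w)\ne0$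 and there is $s\in S$ with $sy<y$ and $sw>w$; or $y=sw>w$ for some $s\in S$. Let $\le_L$ be the transitive closure of $\leftarrow_L$; let $x\le_R y$ mean $x^{-1}\le_L y^{-1}$; let $\le_{LR}$ be the pre-order generated by $\le_L$ and $\le_R$. Left cells and two-sided cells are the equivalence classes of $\le_L$ and $\le_{LR}$, respectively. For a left cell $\Gamma$ let $[\Gamma]_1$ be the $\mathbb{R}[W]$-module with basis $\{e_x\}_{x\in\Gamma}$ and $s.e_y=-e_y$ if $sy<y$, $s.e_y=e_y+\sum_{x\in\Gamma,\,sx<x}\tilde\mu(x,y)e_x$ if $sy>y$. Let $E\in\operatorname{Irr}(W)$ be an irreducible representation of $W$ over $\mathbb{R}$, and let $\mathcal{F}_E$ be the two-sided cell that contains all left cells $\Gamma$ such that $E$ is a constituent of $[\Gamma]_1$. Let $K=\mathbb{R}(v)$, and let $E_v$ be the simple module of $\mathcal{H}_K=K\otimes_{\mathbb{Z}[v,v^{-1}]}\mathcal{H}$ corresponding to $E$ under $v\mapsto1$, i.e. such that $\operatorname{trace}(T_w,E_v)|_{v=1}=\operatorname{trace}(w,E)$ for all $w\in W$. Let $\mathbf{a}_E$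 be the least $i\ge0$ such that $v^i\operatorname{trace}(T_w,E_v)\in\mathbb{R}[v]$ for all $w\in W$, and let $c_{w,E}\in\mathbb{R}$ be the constant coefficient of $(-1)^{l(w)}v^{\mathbf{a}_E}\operatorname{trace}(T_w,E_v)$. Let $w\in W$, and assume that $c_{w,E}\neq0$ for some $E\in\operatorname{Irr}(W)$. Then $w\in\mathcal{F}_E$. -/

import Mathlib

namespace CoxeterSystem

section Exchange

variable {B W : Type*} [Group W] {M : CoxeterMatrix B} (cs : CoxeterSystem M W)

open Classical in
/-- The permutation-type action `(t, ε) ↦ (s t s, ε + [t = s])` used to prove the exchange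
property. -/
noncomputable def exchangeStep (i : B) : Function.End (W × ZMod 2) := fun p =>
  (cs.simple i * p.1 * cs.simple i, p.2 + if p.1 = cs.simple i then 1 else 0)

open Classical in
theorem exchangeStep_word (ω : List B) (t : W) (e : ZMod 2) :
    (ω.map cs.exchangeStep).prod (t, e) =
      (cs.wordProd ω * t * (cs.wordProd ω)⁻¹, e + ((cs.rightInvSeq ω).count t : ZMod 2)) := by
  induction ω with
  | nil => simp; rfl
  | cons i ω ih =>
    have h : ((i :: ω).map cs.exchangeStep).prod (t, e) =
        cs.exchangeStep i ((ω.map cs.exchangeStep).prod (t, e)) := by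
      simp only [List.map_cons, List.prod_cons]; rfl
    rw [h, ih, exchangeStep, rightInvSeq, wordProd_cons, List.count_cons]
    have : cs.wordProd ω * t * (cs.wordProd ω)⁻¹ = cs.simple i ↔
        (cs.wordProd ω)⁻¹ * cs.simple i * cs.wordProd ω = t := by
      constructor
      · intro h; rw [← h]; group
      · intro h; rw [← h]; group
    simp only [this, beq_iff_eq]
    refine Prod.ext ?_ ?_
    · simp [mul_assoc]
    · simp only [add_assoc]; push_cast; rfl

theorem alternatingWord_reverse (i j : B) (m : ℕ) :
    (alternatingWord i j (2 * m)).reverse = alternatingWord j i (2 * m) := by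
  apply List.ext_getElem
  · simp
  · intro k h1 h2
    simp only [List.length_reverse, length_alternatingWord] at h1
    rw [List.getElem_reverse, getElem_alternatingWord _ _ _ _ (by simp; lia),
      getElem_alternatingWord _ _ _ _ h1]
    simp only [length_alternatingWord]
    by_cases h : Even k
    · have : ¬ Even (2 * m + (2 * m - 1 - k)) := by
        rw [Nat.even_iff] at *; lia
      have h' : Even (2 * m + k) := by rw [Nat.even_iff] at *; lia
      simp [this, h']
    · have : Even (2 * m + (2 * m - 1 - k)) := by
        rw [Nat.even_iff] at *; lia
      have h' : ¬ Even (2 * m + k) := by rw [Nat.even_iff] at *; lia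
      simp [this, h']

theorem exchangeStep_pow (i j : B) (m : ℕ) :
    (cs.exchangeStep i * cs.exchangeStep j) ^ m =
      ((alternatingWord i j (2 * m)).map cs.exchangeStep).prod := by
  induction m with
  | zero => simp [alternatingWord]
  | succ m ih =>
    rw [pow_succ, ih, show 2 * (m + 1) = 2 * m + 1 + 1 by ring, alternatingWord_succ,
      alternatingWord_succ]
    simp

open Classical in
theorem exchange_liftable : M.IsLiftable cs.exchangeStep := by
  intro i j
  rw [exchangeStep_pow]
  funext p
  obtain ⟨t, e⟩ := p
  rw [exchangeStep_word]
  have h1 : cs.wordProd (alternatingWord i j (2 * M i j)) = 1 := by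
    rw [prod_alternatingWord_eq_mul_pow]; simp
  have h2 : ((cs.rightInvSeq (alternatingWord i j (2 * M i j))).count t : ZMod 2) = 0 := by
    rw [← alternatingWord_reverse, rightInvSeq_reverse, List.count_reverse]
    set L := cs.leftInvSeq (alternatingWord j i (2 * M i j)) with hL
    have hlen : L.length = 2 * M i j := by simp [hL]
    have : L.take (M i j) = L.drop (M i j) := by
      apply List.ext_getElem
      · simp [hlen]; lia
      · intro k h1 h2
        have hk : k < M i j := by simp [hlen] at h1; lia
        rw [List.getElem_take, List.getElem_drop]
        simp only [hL]
        rw [cs.getElem_leftInvSeq_alternatingWord j i _ _ (by lia),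
          cs.getElem_leftInvSeq_alternatingWord j i _ _ (by lia)]
        rw [prod_alternatingWord_eq_mul_pow, prod_alternatingWord_eq_mul_pow]
        have e1 : ¬ Even (2 * k + 1) := by rw [Nat.even_iff]; lia
        have e2 : ¬ Even (2 * (M i j + k) + 1) := by rw [Nat.even_iff]; lia
        simp only [e1, e2, if_false]
        rw [show (2 * k + 1) / 2 = k by lia, show (2 * (M i j + k) + 1) / 2 = M i j + k by lia,
          pow_add]
        simp
    rw [← List.take_append_drop (M i j) L, List.count_append, this]
    push_cast
    exact CharTwo.add_self_eq_zero _
  rw [h1, h2]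
  simp; rfl

open Classical in
/-- The exchange property: if `t` is a reflection and `ℓ (π ω * t) < ℓ (π ω)` then `t` occurs in
the right inversion sequence of the (not necessarily reduced) word `ω`. -/
theorem mem_rightInvSeq_of_isRightInversion (ω : List B) {t : W}
    (h : cs.IsRightInversion (cs.wordProd ω) t) : t ∈ cs.rightInvSeq ω := by
  set φ : W →* Function.End (W × ZMod 2) := cs.lift ⟨_, cs.exchange_liftable⟩ with hφ
  have hw : ∀ ω : List B, φ (cs.wordProd ω) = (ω.map cs.exchangeStep).prod := by
    intro ω
    rw [wordProd, map_list_prod, List.map_map]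
    congr 2
    funext i
    exact cs.lift_apply_simple cs.exchange_liftable i
  have hfst : ∀ (w t : W) (e : ZMod 2), ∃ n : ZMod 2, ∀ e, φ w (t, e) = (w * t * w⁻¹, e + n) := by
    intro w t _
    obtain ⟨ω, rfl⟩ := cs.wordProd_surjective w
    exact ⟨_, fun e => by rw [hw, exchangeStep_word]⟩
  have hmul : ∀ (a b : W) (p), φ (a * b) p = φ a (φ b p) := fun a b p => by rw [map_mul]; rfl
  have hself : ∀ e, φ t (t, e) = (t, e + 1) := by
    obtain ⟨x, i, rfl⟩ := h.1
    intro e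
    obtain ⟨n, hn⟩ := hfst x⁻¹ (x * cs.simple i * x⁻¹) 0
    obtain ⟨m, hm⟩ := hfst x (cs.simple i) 0
    have hs : ∀ e, φ (cs.simple i) (cs.simple i, e) = (cs.simple i, e + 1) := by
      intro e
      rw [hφ, cs.lift_apply_simple cs.exchange_liftable i, exchangeStep]
      simp
    have hx : x⁻¹ * (x * cs.simple i * x⁻¹) * x⁻¹⁻¹ = cs.simple i := by group
    have h0 : n + m = 0 := by
      have := hmul x x⁻¹ (x * cs.simple i * x⁻¹, 0)
      rw [hn, hx, hm, mul_inv_cancel, map_one] at this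
      have := congrArg Prod.snd this
      rw [← zero_add n]; exact this.symm
    rw [hmul, hmul, hn, hx, hs, hm]
    refine Prod.ext rfl ?_
    linear_combination h0
  by_contra hmem
  have hN : φ (cs.wordProd ω) (t, 1) = (cs.wordProd ω * t * (cs.wordProd ω)⁻¹, 1) := by
    rw [hw, exchangeStep_word, List.count_eq_zero_of_not_mem hmem]; simp
  obtain ⟨ω', hred, hω'⟩ := cs.exists_isReduced (cs.wordProd ω * t)
  have hN' : (φ (cs.wordProd ω * t) (t, 0)).2 = 1 := by
    rw [hmul, hself, zero_add, hN]
  rw [hω', hw, exchangeStep_word] at hN'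
  have hmem' : t ∈ cs.rightInvSeq ω' := by
    by_contra hc
    rw [List.count_eq_zero_of_not_mem hc] at hN'
    simp at hN'
  have := (cs.isRightInversion_of_mem_rightInvSeq hred hmem').2
  rw [← hω', mul_assoc, h.1.mul_self, mul_one] at this
  exact absurd this (not_lt.mpr h.2.le)

/-- If a reflection `t` increases the length of `w` but does not increase that of `s w`, then
`s w = w t`. -/
theorem simple_mul_eq_mul_reflection {w t : W} (i : B) (ht : cs.IsReflection t)
    (h1 : cs.length w < cs.length (w * t))
    (h2 : cs.length (cs.simple i * w * t) < cs.length (cs.simple i * w)) :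
    cs.simple i * w = w * t := by
  obtain ⟨ω, hred, rfl⟩ := cs.exists_isReduced w
  have hm := cs.mem_rightInvSeq_of_isRightInversion (i :: ω) (t := t)
    ⟨ht, by rwa [wordProd_cons]⟩
  rw [rightInvSeq, List.mem_cons] at hm
  rcases hm with hm | hm
  · rw [hm]; group
  · exact absurd (cs.isRightInversion_of_mem_rightInvSeq hred hm).2 (not_lt.mpr h1.le)

end Exchange

end CoxeterSystem
namespace CoxeterSystem

section HeckeAlgebra

variable {B W : Type*} [Group W] {M : CoxeterMatrix B} (cs : CoxeterSystem M W)
  {R : Type*} [CommRing R] (v : Rˣ)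

open Classical in
/-- Left multiplication by `T_s` on the free module with basis `W`:
`w ↦ s w` if `ℓ (s w) > ℓ w`, and `w ↦ s w + (v - v⁻¹) w` if `ℓ (s w) < ℓ w`. -/
noncomputable def heckeLeftOp (i : B) : Module.End R (W →₀ R) :=
  Finsupp.linearCombination R fun w =>
    Finsupp.single (cs.simple i * w) 1 +
      if cs.length (cs.simple i * w) < cs.length w
      then Finsupp.single w ((v : R) - ((v⁻¹ : Rˣ) : R)) else 0

open Classical in
/-- Right multiplication by `T_s` on the free module with basis `W` (auxiliary). -/
noncomputable def heckeRightOp (i : B) : Module.End R (W →₀ R) :=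
  Finsupp.linearCombination R fun w =>
    Finsupp.single (w * cs.simple i) 1 +
      if cs.length (w * cs.simple i) < cs.length w
      then Finsupp.single w ((v : R) - ((v⁻¹ : Rˣ) : R)) else 0

/-- The one-parameter Iwahori–Hecke algebra of `(W, S)` over `R` with parameter `v ∈ Rˣ`, realised
as the algebra of operators on the free `R`-module with basis `W` generated by the left
multiplications by the `T_s`.  By `heckeT` and `heckeGen_mul_heckeT` below it is free over `R` with
a basis `T_w` (`w ∈ W`) which satisfies the defining multiplication rule. -/
def Hecke : Type _ := ↥(Algebra.adjoin R (Set.range (cs.heckeLeftOp v)))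

noncomputable instance : Semiring (cs.Hecke v) :=
  inferInstanceAs (Semiring ↥(Algebra.adjoin R (Set.range (cs.heckeLeftOp v))))

noncomputable instance : Algebra R (cs.Hecke v) :=
  inferInstanceAs (Algebra R ↥(Algebra.adjoin R (Set.range (cs.heckeLeftOp v))))

noncomputable instance : Ring (cs.Hecke v) := Algebra.semiringToRing R

/-- The inclusion of the Hecke algebra into the operators on the free module with basis `W`. -/
noncomputable def heckeOp : cs.Hecke v →ₐ[R] Module.End R (W →₀ R) :=
  (Algebra.adjoin R (Set.range (cs.heckeLeftOp v))).val

/-- The generator `T_s` of the Hecke algebra. -/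
noncomputable def heckeGen (i : B) : cs.Hecke v :=
  ⟨cs.heckeLeftOp v i, Algebra.subset_adjoin ⟨i, rfl⟩⟩

theorem heckeOp_heckeGen (i : B) : cs.heckeOp v (cs.heckeGen v i) = cs.heckeLeftOp v i := rfl

open Classical in
theorem heckeLeftOp_single (i : B) (w : W) :
    cs.heckeLeftOp v i (Finsupp.single w 1) = Finsupp.single (cs.simple i * w) 1 +
      if cs.length (cs.simple i * w) < cs.length w
      then ((v : R) - ((v⁻¹ : Rˣ) : R)) • Finsupp.single w 1 else 0 := by
  simp [heckeLeftOp]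

open Classical in
theorem heckeRightOp_single (i : B) (w : W) :
    cs.heckeRightOp v i (Finsupp.single w 1) = Finsupp.single (w * cs.simple i) 1 +
      if cs.length (w * cs.simple i) < cs.length w
      then ((v : R) - ((v⁻¹ : Rˣ) : R)) • Finsupp.single w 1 else 0 := by
  simp [heckeRightOp]

theorem simple_mul_eq_mul_simple {w : W} (i j : B)
    (h1 : cs.length (cs.simple i * w) = cs.length (w * cs.simple j))
    (h2 : cs.length (cs.simple i * w * cs.simple j) = cs.length w) :
    cs.simple i * w = w * cs.simple j := by
  rcases lt_or_gt_of_ne (cs.length_mul_simple_ne w j) with h | h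
  · have h3 := cs.simple_mul_eq_mul_reflection (w := cs.simple i * w) i (cs.isReflection_simple j)
      (by lia) (by rw [simple_mul_simple_cancel_left]; lia)
    rw [simple_mul_simple_cancel_left] at h3
    nth_rw 2 [h3]
    simp [mul_assoc]
  · exact cs.simple_mul_eq_mul_reflection i (cs.isReflection_simple j) h (by lia)

theorem heckeLeftOp_comm (i j : B) :
    cs.heckeLeftOp v i * cs.heckeRightOp v j = cs.heckeRightOp v j * cs.heckeLeftOp v i := by
  classical
  refine Finsupp.lhom_ext' fun w => LinearMap.ext_ring ?_
  simp only [LinearMap.comp_apply, Finsupp.lsingle_apply, Module.End.mul_apply]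
  have key := cs.simple_mul_eq_mul_simple (w := w) i j
  have a1 := cs.length_simple_mul w i
  have a2 := cs.length_mul_simple w j
  have a3 := cs.length_simple_mul (w * cs.simple j) i
  have a4 := cs.length_mul_simple (cs.simple i * w) j
  rw [← mul_assoc] at a3
  rw [heckeLeftOp_single, heckeRightOp_single, map_add, map_add, heckeLeftOp_single,
    heckeRightOp_single, ← mul_assoc]
  simp only [apply_ite, map_smul, map_zero, heckeLeftOp_single, heckeRightOp_single]
  by_cases hk : cs.length (cs.simple i * w) = cs.length (w * cs.simple j) ∧
      cs.length (cs.simple i * w * cs.simple j) = cs.length w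
  · have := key hk.1 hk.2
    rw [this]
    split_ifs <;> rfl
  · split_ifs <;> first | rfl | (exfalso; lia) | module

/-- The coordinates of an element of the Hecke algebra, as a linear map. -/
noncomputable def heckeEval : cs.Hecke v →ₗ[R] (W →₀ R) :=
  (LinearMap.applyₗ (Finsupp.single (1 : W) (1 : R))).comp (cs.heckeOp v).toLinearMap

theorem heckeEval_apply (h : cs.Hecke v) :
    cs.heckeEval v h = cs.heckeOp v h (Finsupp.single 1 1) := rfl

theorem heckeEval_mul (h k : cs.Hecke v) :
    cs.heckeEval v (h * k) = cs.heckeOp v h (cs.heckeEval v k) := by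
  simp [heckeEval_apply]

theorem heckeOp_comm (h : cs.Hecke v) (j : B) :
    cs.heckeOp v h * cs.heckeRightOp v j = cs.heckeRightOp v j * cs.heckeOp v h := by
  have : cs.heckeOp v h ∈ Subalgebra.centralizer R (Set.range (cs.heckeRightOp v)) := by
    refine (Algebra.adjoin_le ?_ : Algebra.adjoin R (Set.range (cs.heckeLeftOp v)) ≤ _) h.2
    rintro _ ⟨i, rfl⟩
    rw [SetLike.mem_coe, Subalgebra.mem_centralizer_iff]
    rintro _ ⟨j, rfl⟩
    exact (cs.heckeLeftOp_comm v i j).symm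
  rw [Subalgebra.mem_centralizer_iff] at this
  exact (this _ ⟨j, rfl⟩).symm

theorem heckeEval_bijective : Function.Bijective (cs.heckeEval v) := by
  classical
  constructor
  · rw [injective_iff_map_eq_zero]
    intro h hh
    have : cs.heckeOp v h = 0 := by
      refine Finsupp.lhom_ext' fun w => LinearMap.ext_ring ?_
      simp only [LinearMap.comp_apply, Finsupp.lsingle_apply, LinearMap.zero_apply]
      induction hn : cs.length w generalizing w with
      | zero =>
        rw [cs.length_eq_zero_iff] at hn
        rw [hn]; exact hh
      | succ n ih =>
        have hw : w ≠ 1 := by rintro rfl; simp at hn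
        obtain ⟨j, hj⟩ := cs.exists_rightDescent_of_ne_one hw
        have hj' : cs.length (w * cs.simple j) < cs.length w := hj
        have := cs.length_mul_simple w j
        have h1 := cs.heckeRightOp_single v j (w * cs.simple j)
        rw [simple_mul_simple_cancel_right, if_neg (by lia), add_zero] at h1
        rw [← h1, ← Module.End.mul_apply, heckeOp_comm, Module.End.mul_apply,
          ih (w * cs.simple j) (by lia), map_zero]
    exact Subtype.ext this
  · have hs : ∀ w : W, ∃ h : cs.Hecke v, cs.heckeEval v h = Finsupp.single w 1 := by
      intro w
      induction hn : cs.length w generalizing w with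
      | zero =>
        rw [cs.length_eq_zero_iff] at hn
        exact ⟨1, by rw [hn, heckeEval_apply, map_one]; rfl⟩
      | succ n ih =>
        have hw : w ≠ 1 := by rintro rfl; simp at hn
        obtain ⟨i, hi⟩ := cs.exists_leftDescent_of_ne_one hw
        have hi' : cs.length (cs.simple i * w) < cs.length w := hi
        have := cs.length_simple_mul w i
        obtain ⟨h, hh⟩ := ih (cs.simple i * w) (by lia)
        refine ⟨cs.heckeGen v i * h, ?_⟩
        rw [heckeEval_mul, hh, heckeOp_heckeGen, heckeLeftOp_single,
          simple_mul_simple_cancel_left, if_neg (by lia), add_zero]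
    intro f
    induction f using Finsupp.induction_linear with
    | zero => exact ⟨0, map_zero _⟩
    | add f g hf hg =>
      obtain ⟨a, rfl⟩ := hf
      obtain ⟨b, rfl⟩ := hg
      exact ⟨a + b, map_add _ _ _⟩
    | single w r =>
      obtain ⟨h, hh⟩ := hs w
      exact ⟨r • h, by rw [map_smul, hh, Finsupp.smul_single, smul_eq_mul, mul_one]⟩

/-- The standard basis `T_w` (`w ∈ W`) of the Hecke algebra. -/
noncomputable def heckeT : Module.Basis W R (cs.Hecke v) :=
  Module.Basis.ofRepr (LinearEquiv.ofBijective (cs.heckeEval v) (cs.heckeEval_bijective v))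

theorem heckeT_repr (h : cs.Hecke v) : (cs.heckeT v).repr h = cs.heckeEval v h := rfl

theorem heckeT_one : cs.heckeT v 1 = 1 := by
  apply (cs.heckeEval_bijective v).1
  rw [← heckeT_repr, Module.Basis.repr_self, heckeEval_apply, map_one]; rfl

open Classical in
/-- The multiplication rule of the Hecke algebra: `T_s T_w = T_{sw}` if `ℓ (s w) > ℓ w` and
`T_s T_w = T_{sw} + (v - v⁻¹) T_w` if `ℓ (s w) < ℓ w`. -/
theorem heckeGen_mul_heckeT (i : B) (w : W) :
    cs.heckeGen v i * cs.heckeT v w = cs.heckeT v (cs.simple i * w) +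
      if cs.length (cs.simple i * w) < cs.length w
      then ((v : R) - ((v⁻¹ : Rˣ) : R)) • cs.heckeT v w else 0 := by
  apply (cs.heckeEval_bijective v).1
  rw [heckeEval_mul, map_add, apply_ite (cs.heckeEval v), map_smul, map_zero]
  simp only [← heckeT_repr, Module.Basis.repr_self]
  rw [heckeOp_heckeGen, heckeLeftOp_single]

theorem heckeT_simple (i : B) : cs.heckeT v (cs.simple i) = cs.heckeGen v i := by
  have := cs.heckeGen_mul_heckeT v i 1
  rw [heckeT_one, mul_one, mul_one, if_neg (by simp), add_zero] at this
  exact this.symm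

open Classical in
theorem heckeT_repr_gen_mul (i : B) (h : cs.Hecke v) (y : W) :
    (cs.heckeT v).repr (cs.heckeGen v i * h) y = (cs.heckeT v).repr h (cs.simple i * y) +
      if cs.length (cs.simple i * y) < cs.length y
      then ((v : R) - ((v⁻¹ : Rˣ) : R)) * (cs.heckeT v).repr h y else 0 := by
  rw [heckeT_repr, heckeT_repr, heckeEval_mul, heckeOp_heckeGen]
  generalize cs.heckeEval v h = f
  induction f using Finsupp.induction_linear with
  | zero => simp
  | add f g hf hg =>
    rw [map_add, Finsupp.add_apply, hf, hg, Finsupp.add_apply, Finsupp.add_apply]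
    split_ifs <;> ring
  | single w r =>
    have hr : Finsupp.single w r = r • Finsupp.single w (1 : R) := by simp
    rw [hr, map_smul, heckeLeftOp_single]
    have e : cs.simple i * w = y ↔ w = cs.simple i * y := by
      constructor <;> rintro rfl <;> simp
    by_cases h1 : w = y
    · subst h1
      by_cases h2 : cs.simple i * w = w
      · exact absurd (congrArg cs.length h2) (cs.length_simple_mul_ne w i)
      · have h3 : ¬ w = cs.simple i * w := fun h => h2 h.symm
        simp only [Finsupp.smul_apply, Finsupp.add_apply, Finsupp.single_apply, e, h3, if_false]
        split_ifs <;> simp [mul_comm]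
    · simp only [Finsupp.smul_apply, Finsupp.add_apply, Finsupp.single_apply, e, h1, if_false]
      split_ifs <;> simp [h1]

/-- The quadratic relation in the form that gives the inverse of `T_s`. -/
theorem heckeGen_mul_self (i : B) : cs.heckeGen v i * cs.heckeGen v i =
    1 + ((v : R) - ((v⁻¹ : Rˣ) : R)) • cs.heckeGen v i := by
  have := cs.heckeGen_mul_heckeT v i (cs.simple i)
  rwa [simple_mul_simple_self, heckeT_one, heckeT_simple, if_pos (by simp)] at this

end HeckeAlgebra

end CoxeterSystem
namespace CoxeterSystem

section KazhdanLusztig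

open LaurentPolynomial

variable {B W : Type*} [Group W] {M : CoxeterMatrix B} (cs : CoxeterSystem M W)

/-- The indeterminate `v`, as a unit of the ring `ℤ[v, v⁻¹]` of Laurent polynomials. -/
noncomputable def laurentV : (ℤ[T;T⁻¹])ˣ where
  val := T 1
  inv := T (-1)
  val_inv := by rw [← T_add]; simp
  inv_val := by rw [← T_add]; simp

theorem val_laurentV : (laurentV : ℤ[T;T⁻¹]) = T 1 := rfl

theorem val_inv_laurentV : ((laurentV⁻¹ : (ℤ[T;T⁻¹])ˣ) : ℤ[T;T⁻¹]) = T (-1) := rfl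

/-- The generic one-parameter Iwahori–Hecke algebra over `ℤ[v, v⁻¹]`. -/
abbrev GenericHecke : Type _ := cs.Hecke laurentV

/-- The bar involution of the generic Iwahori–Hecke algebra:
`∑ a_w(v) T_w ↦ ∑ a_w(v⁻¹) (T_{w⁻¹})⁻¹`. -/
noncomputable def heckeBar (h : cs.GenericHecke) : cs.GenericHecke :=
  ((cs.heckeT laurentV).repr h).sum fun w a => invert a • Ring.inverse (cs.heckeT laurentV w⁻¹)

/-- The Bruhat–Chevalley order: `x ≤ y` if `y` is reached from `x` by successive
length-increasing multiplications by reflections. -/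
def BruhatLE (x y : W) : Prop :=
  Relation.ReflTransGen
    (fun a b => ∃ t, cs.IsReflection t ∧ b = a * t ∧ cs.length a < cs.length b) x y

/-- The strict Bruhat–Chevalley order. -/
def BruhatLT (x y : W) : Prop := cs.BruhatLE x y ∧ x ≠ y

/-- `C` is a Kazhdan–Lusztig element for `w` with coefficients
`P y = P_{y,w} ∈ ℤ[v]` (`y ∈ W`): it is fixed by the bar involution,
`C = ∑_y v ^ (ℓ y - ℓ w) P_{y,w} T_y`, `P_{w,w} = 1`, `P_{y,w} = 0` unless `y ≤ w`, and
`deg P_{y,w} ≤ ℓ w - ℓ y - 1` for `y < w`. -/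
structure IsKLElement (w : W) (C : cs.GenericHecke) (P : W → Polynomial ℤ) : Prop where
  bar_eq : cs.heckeBar C = C
  repr_eq : ∀ y, (cs.heckeT laurentV).repr C y =
    T ((cs.length y : ℤ) - cs.length w) * Polynomial.toLaurent (P y)
  self_eq : P w = 1
  eq_zero : ∀ y, ¬ cs.BruhatLE y w → P y = 0
  degree_lt : ∀ y, cs.BruhatLT y w → (P y).degree < ((cs.length w - cs.length y : ℕ) : WithBot ℕ)

/-! ### Existence and uniqueness of the Kazhdan–Lusztig basis -/

local notation "qq" => (((laurentV : (ℤ[T;T⁻¹])ˣ) : ℤ[T;T⁻¹]) -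
  (((laurentV : (ℤ[T;T⁻¹])ˣ)⁻¹ : (ℤ[T;T⁻¹])ˣ) : ℤ[T;T⁻¹]))

theorem heckeT_mul_gen {R : Type*} [CommRing R] (v : Rˣ) (u : W) (i : B)
    (h : cs.length u < cs.length (u * cs.simple i)) :
    cs.heckeT v (u * cs.simple i) = cs.heckeT v u * cs.heckeGen v i := by
  classical
  apply (cs.heckeEval_bijective v).1
  rw [heckeEval_mul, ← heckeT_simple, ← heckeT_repr, ← heckeT_repr, Module.Basis.repr_self,
    Module.Basis.repr_self]
  have h1 := cs.heckeRightOp_single v i 1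
  rw [one_mul, if_neg (by simp), add_zero] at h1
  have h2 : cs.heckeOp v (cs.heckeT v u) (Finsupp.single 1 1) = Finsupp.single u 1 := by
    rw [← heckeEval_apply, ← heckeT_repr, Module.Basis.repr_self]
  rw [← h1, ← Module.End.mul_apply, heckeOp_comm, Module.End.mul_apply, h2, heckeRightOp_single,
    if_neg (by lia), add_zero]

theorem heckeGen_mul_inv {R : Type*} [CommRing R] (v : Rˣ) (i : B) :
    cs.heckeGen v i * (cs.heckeGen v i - algebraMap R _ ((v : R) - ((v⁻¹ : Rˣ) : R))) = 1 := by
  rw [mul_sub, heckeGen_mul_self, Algebra.smul_def, Algebra.commutes]; abel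

theorem heckeGen_inv_mul {R : Type*} [CommRing R] (v : Rˣ) (i : B) :
    (cs.heckeGen v i - algebraMap R _ ((v : R) - ((v⁻¹ : Rˣ) : R))) * cs.heckeGen v i = 1 := by
  rw [sub_mul, heckeGen_mul_self, Algebra.smul_def]; abel

/-- The unit `T_s`. -/
noncomputable def heckeGenUnit {R : Type*} [CommRing R] (v : Rˣ) (i : B) : (cs.Hecke v)ˣ :=
  ⟨cs.heckeGen v i, _, cs.heckeGen_mul_inv v i, cs.heckeGen_inv_mul v i⟩

theorem isUnit_heckeT {R : Type*} [CommRing R] (v : Rˣ) (w : W) : IsUnit (cs.heckeT v w) := by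
  induction hn : cs.length w generalizing w with
  | zero =>
    rw [cs.length_eq_zero_iff] at hn
    rw [hn, heckeT_one]; exact isUnit_one
  | succ n ih =>
    have hw : w ≠ 1 := by rintro rfl; simp at hn
    obtain ⟨j, hj⟩ := cs.exists_rightDescent_of_ne_one hw
    have hj' : cs.length (w * cs.simple j) < cs.length w := hj
    have := cs.length_mul_simple w j
    have h1 := cs.heckeT_mul_gen v (w * cs.simple j) j
      (by rwa [simple_mul_simple_cancel_right])
    rw [simple_mul_simple_cancel_right] at h1
    rw [h1]
    exact (ih _ (by lia)).mul (cs.heckeGenUnit v j).isUnit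

theorem inverse_heckeT_simple_mul (w : W) (i : B)
    (h : cs.length w < cs.length (cs.simple i * w)) :
    Ring.inverse (cs.heckeT laurentV (cs.simple i * w)⁻¹) =
      (cs.heckeGen laurentV i - algebraMap _ _ qq) * Ring.inverse (cs.heckeT laurentV w⁻¹) := by
  rw [mul_inv_rev, inv_simple, heckeT_mul_gen]
  · obtain ⟨a, ha⟩ := cs.isUnit_heckeT laurentV w⁻¹
    rw [← ha, show cs.heckeGen laurentV i = (cs.heckeGenUnit laurentV i : cs.GenericHecke) from rfl,
      ← Units.val_mul, Ring.inverse_unit, Ring.inverse_unit, mul_inv_rev, Units.val_mul]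
    rfl
  · rw [← cs.length_inv (w⁻¹ * cs.simple i)]; simpa using h

theorem heckeBar_add (h k : cs.GenericHecke) :
    cs.heckeBar (h + k) = cs.heckeBar h + cs.heckeBar k := by
  rw [heckeBar, map_add, Finsupp.sum_add_index']
  · rfl
  · simp
  · intros; rw [map_add, add_smul]

theorem heckeBar_sub (h k : cs.GenericHecke) :
    cs.heckeBar (h - k) = cs.heckeBar h - cs.heckeBar k := by
  rw [eq_sub_iff_add_eq, ← heckeBar_add, sub_add_cancel]

theorem heckeBar_zero : cs.heckeBar 0 = 0 := by simp [heckeBar]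

theorem heckeBar_smul (a : ℤ[T;T⁻¹]) (h : cs.GenericHecke) :
    cs.heckeBar (a • h) = invert a • cs.heckeBar h := by
  rw [heckeBar, map_smul, Finsupp.sum_smul_index (by simp), heckeBar, Finsupp.smul_sum]
  simp [mul_smul]

theorem heckeBar_heckeT (w : W) :
    cs.heckeBar (cs.heckeT laurentV w) = Ring.inverse (cs.heckeT laurentV w⁻¹) := by
  rw [heckeBar, Module.Basis.repr_self, Finsupp.sum_single_index (by simp)]; simp

theorem invert_qq : invert (qq : ℤ[T;T⁻¹]) = - qq := by
  rw [val_laurentV, val_inv_laurentV, map_sub, invert_T, invert_T]; simp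

theorem hecke_induction {p : cs.GenericHecke → Prop} (h : cs.GenericHecke) (zero : p 0)
    (add : ∀ a b, p a → p b → p (a + b)) (smul : ∀ (r : ℤ[T;T⁻¹]) a, p a → p (r • a))
    (basis : ∀ w, p (cs.heckeT laurentV w)) : p h := by
  have := (cs.heckeT laurentV).mem_span h
  induction this using Submodule.span_induction with
  | mem x hx => obtain ⟨w, rfl⟩ := hx; exact basis w
  | zero => exact zero
  | add a b _ _ ha hb => exact add _ _ ha hb
  | smul r a _ ha => exact smul _ _ ha

theorem heckeBar_gen_mul (i : B) (h : cs.GenericHecke) :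
    cs.heckeBar (cs.heckeGen laurentV i * h) =
      (cs.heckeGen laurentV i - algebraMap _ _ qq) * cs.heckeBar h := by
  classical
  induction h using cs.hecke_induction with
  | zero => simp [heckeBar_zero]
  | add a b ha hb => rw [mul_add, heckeBar_add, ha, hb, heckeBar_add, mul_add]
  | smul r a ha => rw [mul_smul_comm, heckeBar_smul, ha, heckeBar_smul, mul_smul_comm]
  | basis w =>
    rw [heckeGen_mul_heckeT, heckeBar_add, heckeBar_heckeT, heckeBar_heckeT]
    split_ifs with h
    · have h1 := cs.inverse_heckeT_simple_mul (cs.simple i * w) i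
        (by rwa [simple_mul_simple_cancel_left])
      rw [simple_mul_simple_cancel_left] at h1
      have h2 : Ring.inverse (cs.heckeT laurentV (cs.simple i * w)⁻¹) =
          cs.heckeGen laurentV i * Ring.inverse (cs.heckeT laurentV w⁻¹) := by
        rw [h1, ← mul_assoc, heckeGen_mul_inv, one_mul]
      rw [h2, heckeBar_smul, heckeBar_heckeT, invert_qq, sub_mul, Algebra.smul_def, map_neg,
        neg_mul, ← sub_eq_add_neg]
    · rw [heckeBar_zero, add_zero]
      have := cs.length_simple_mul_ne w i
      exact cs.inverse_heckeT_simple_mul w i (by lia)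

theorem BruhatLE.length_le {x y : W} (h : cs.BruhatLE x y) : cs.length x ≤ cs.length y := by
  induction h with
  | refl => exact le_rfl
  | tail _ h ih => obtain ⟨_, _, _, h⟩ := h; lia

theorem BruhatLE.eq_or_length_lt {x y : W} (h : cs.BruhatLE x y) :
    x = y ∨ cs.length x < cs.length y := by
  rcases Relation.ReflTransGen.cases_tail h with h | ⟨z, h1, _, _, _, h2⟩
  · exact Or.inl h.symm
  · exact Or.inr (lt_of_le_of_lt (BruhatLE.length_le cs h1) h2)

theorem BruhatLE.trans {x y z : W} (h : cs.BruhatLE x y) (h' : cs.BruhatLE y z) :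
    cs.BruhatLE x z := Relation.ReflTransGen.trans h h'

theorem bruhatLE_simple_mul {w : W} (i : B) (h : cs.length w < cs.length (cs.simple i * w)) :
    cs.BruhatLE w (cs.simple i * w) := by
  refine Relation.ReflTransGen.single ⟨w⁻¹ * cs.simple i * w, ⟨w⁻¹, i, by simp⟩, ?_, h⟩
  group

theorem BruhatLE.simple_mul {x y : W} (i : B) (h : cs.BruhatLE x y) :
    cs.BruhatLE (cs.simple i * x) y ∨ cs.BruhatLE (cs.simple i * x) (cs.simple i * y) := by
  induction h using Relation.ReflTransGen.head_induction_on with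
  | refl => exact Or.inr Relation.ReflTransGen.refl
  | head h1 h2 ih =>
    rename_i a c
    obtain ⟨t, ht, rfl, hl⟩ := h1
    by_cases h3 : cs.length (cs.simple i * a) < cs.length (cs.simple i * (a * t))
    · have h4 : cs.BruhatLE (cs.simple i * a) (cs.simple i * (a * t)) :=
        Relation.ReflTransGen.single ⟨t, ht, (mul_assoc _ _ _).symm, h3⟩
      exact ih.imp (BruhatLE.trans cs h4) (BruhatLE.trans cs h4)
    · have h5 := ht.length_mul_left_ne (cs.simple i * a)
      rw [mul_assoc] at h5
      left
      rw [cs.simple_mul_eq_mul_reflection i ht hl (by rw [mul_assoc]; lia)]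
      exact h2

open Classical in
theorem heckeBar_heckeT_repr (w y : W) (h : cs.length w ≤ cs.length y) :
    (cs.heckeT laurentV).repr (cs.heckeBar (cs.heckeT laurentV w)) y = if w = y then 1 else 0 := by
  induction hn : cs.length w generalizing w y with
  | zero =>
    rw [cs.length_eq_zero_iff] at hn
    subst hn
    rw [heckeBar_heckeT, inv_one, heckeT_one, Ring.inverse_one, ← heckeT_one,
      Module.Basis.repr_self, Finsupp.single_apply]
  | succ n ih =>
    have hw : w ≠ 1 := by rintro rfl; simp at hn
    obtain ⟨i, hi⟩ := cs.exists_leftDescent_of_ne_one hw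
    have hi' : cs.length (cs.simple i * w) < cs.length w := hi
    obtain ⟨u, rfl⟩ : ∃ u, w = cs.simple i * u :=
      ⟨cs.simple i * w, by rw [simple_mul_simple_cancel_left]⟩
    rw [simple_mul_simple_cancel_left] at hi'
    have h1 := cs.length_simple_mul u i
    have h2 := cs.length_simple_mul y i
    have hT : cs.heckeT laurentV (cs.simple i * u) =
        cs.heckeGen laurentV i * cs.heckeT laurentV u := by
      rw [heckeGen_mul_heckeT, if_neg (by lia), add_zero]
    have huy : u ≠ y := by rintro rfl; lia
    rw [hT, heckeBar_gen_mul, sub_mul, ← Algebra.smul_def, map_sub, map_smul, Finsupp.sub_apply,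
      heckeT_repr_gen_mul, Finsupp.smul_apply, ih u y (by lia) (by lia),
      ih u (cs.simple i * y) (by lia) (by lia), if_neg huy]
    have e : cs.simple i * u = y ↔ u = cs.simple i * y := by
      constructor <;> rintro rfl <;> simp
    simp [e]

theorem heckeBar_repr (h : cs.GenericHecke) (y : W) :
    (cs.heckeT laurentV).repr (cs.heckeBar h) y =
      ((cs.heckeT laurentV).repr h).sum fun w a =>
        invert a * (cs.heckeT laurentV).repr (cs.heckeBar (cs.heckeT laurentV w)) y := by
  rw [heckeBar, Finsupp.sum, map_sum, Finsupp.finsetSum_apply, Finsupp.sum]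
  simp [heckeBar_heckeT]

/-- A bar-invariant element with coefficients in `v⁻¹ ℤ[v⁻¹]` vanishes. -/
theorem eq_zero_of_heckeBar_eq (h : cs.GenericHecke) (hb : cs.heckeBar h = h)
    (hn : ∀ y, ∀ n : ℤ, 0 ≤ n → ((cs.heckeT laurentV).repr h y).coeff n = 0) : h = 0 := by
  classical
  by_contra h0
  have hs : ((cs.heckeT laurentV).repr h).support.Nonempty := by
    rw [Finsupp.support_nonempty_iff]; simpa using h0
  obtain ⟨y, hy, hmax⟩ := Finset.exists_max_image _ cs.length hs
  have h1 := cs.heckeBar_repr h y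
  rw [hb, Finsupp.sum, Finset.sum_eq_single y] at h1
  · rw [heckeBar_heckeT_repr _ _ _ le_rfl, if_pos rfl, mul_one] at h1
    rw [Finsupp.mem_support_iff] at hy
    apply hy
    ext n
    rcases le_or_gt 0 n with h2 | h2
    · rw [hn y n h2]; rfl
    · rw [h1, invert_apply, hn y (-n) (by lia)]; rfl
  · intro z hz hzy
    rw [heckeBar_heckeT_repr _ _ _ (hmax z hz), if_neg hzy, mul_zero]
  · intro h; exact absurd hy h

theorem IsKLElement.degree_lt' {w : W} {C : cs.GenericHecke} {P : W → Polynomial ℤ}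
    (h : cs.IsKLElement w C P) {y : W} (hy : y ≠ w) :
    (P y).degree < ((cs.length w - cs.length y : ℕ) : WithBot ℕ) := by
  by_cases hyw : cs.BruhatLE y w
  · exact h.degree_lt y ⟨hyw, hy⟩
  · rw [h.eq_zero y hyw, Polynomial.degree_zero]; exact WithBot.bot_lt_coe _

theorem coeff_T_mul (m n : ℤ) (f : ℤ[T;T⁻¹]) : (T m * f).coeff n = f.coeff (n - m) := by
  induction f using LaurentPolynomial.induction_on' with
  | add p q hp hq => rw [mul_add, AddMonoidAlgebra.coeff_add, AddMonoidAlgebra.coeff_add,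
      Finsupp.add_apply, Finsupp.add_apply, hp, hq]
  | C_mul_T k a =>
    rw [mul_left_comm, ← T_add, ← single_eq_C_mul_T, ← single_eq_C_mul_T,
      AddMonoidAlgebra.coeff_single, AddMonoidAlgebra.coeff_single, Finsupp.single_apply,
      Finsupp.single_apply]
    congr 1
    simp only [eq_iff_iff]; constructor <;> intro h <;> linarith

theorem toLaurent_coeff_natCast (f : Polynomial ℤ) (n : ℕ) :
    (Polynomial.toLaurent f).coeff (n : ℤ) = f.coeff n := by
  rw [coeff_toLaurent]
  exact Finsupp.mapDomain_apply (Nat.castEmbedding (R := ℤ)).injective _ n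

theorem toLaurent_coeff_of_neg (f : Polynomial ℤ) {n : ℤ} (hn : n < 0) :
    (Polynomial.toLaurent f).coeff n = 0 := by
  rw [coeff_toLaurent]
  refine Finsupp.mapDomain_of_notMem_range _ _ ?_
  rintro ⟨k, rfl⟩
  simp at hn
  lia

theorem IsKLElement.coeff_eq_zero {w : W} {C : cs.GenericHecke} {P : W → Polynomial ℤ}
    (h : cs.IsKLElement w C P) {y : W} (hy : y ≠ w) (n : ℤ) (hn : 0 ≤ n) :
    ((cs.heckeT laurentV).repr C y).coeff n = 0 := by
  rw [h.repr_eq, coeff_T_mul]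
  have h1 := h.degree_lt' cs hy
  rcases lt_or_ge (n - ((cs.length y : ℤ) - cs.length w)) 0 with h2 | h2
  · exact toLaurent_coeff_of_neg _ h2
  · obtain ⟨k, hk⟩ := Int.eq_ofNat_of_zero_le h2
    rw [hk]
    refine (toLaurent_coeff_natCast _ _).trans (Polynomial.coeff_eq_zero_of_degree_lt ?_)
    exact lt_of_lt_of_le h1 (by exact_mod_cast (by lia : cs.length w - cs.length y ≤ k))

/-- The Kazhdan–Lusztig element and polynomials for `w` are unique. -/
theorem IsKLElement.unique {w : W} {C C' : cs.GenericHecke} {P P' : W → Polynomial ℤ}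
    (h : cs.IsKLElement w C P) (h' : cs.IsKLElement w C' P') : C = C' ∧ P = P' := by
  have hC : C = C' := by
    rw [← sub_eq_zero]
    apply cs.eq_zero_of_heckeBar_eq
    · rw [heckeBar_sub, h.bar_eq, h'.bar_eq]
    · intro y n hn
      rw [map_sub, Finsupp.sub_apply]
      by_cases hy : y = w
      · rw [h.repr_eq, h'.repr_eq, hy, h.self_eq, h'.self_eq, sub_self]; rfl
      · rw [AddMonoidAlgebra.coeff_sub, Finsupp.sub_apply, h.coeff_eq_zero cs hy n hn,
          h'.coeff_eq_zero cs hy n hn, sub_zero]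
  refine ⟨hC, funext fun y => ?_⟩
  have h1 := h.repr_eq y
  rw [hC, h'.repr_eq y] at h1
  symm
  exact Polynomial.toLaurent_injective ((isUnit_T _).mul_right_injective h1)

end KazhdanLusztig

end CoxeterSystem
namespace CoxeterSystem

section KazhdanLusztigExistence

open LaurentPolynomial

variable {B W : Type*} [Group W] {M : CoxeterMatrix B} (cs : CoxeterSystem M W)

open Classical in
theorem isKLElement_one : cs.IsKLElement 1 1 (fun y => if y = 1 then 1 else 0) := by
  refine ⟨?_, fun y => ?_, by simp, fun y hy => ?_, fun y hy => ?_⟩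
  · rw [← heckeT_one, heckeBar_heckeT, inv_one, heckeT_one, Ring.inverse_one]
  · rw [← heckeT_one, Module.Basis.repr_self, Finsupp.single_apply]
    by_cases h : y = 1
    · subst h; simp
    · simp [h, Ne.symm h]
  · refine if_neg ?_
    rintro rfl; exact hy Relation.ReflTransGen.refl
  · rw [if_neg hy.2, Polynomial.degree_zero]; exact WithBot.bot_lt_coe _

theorem heckeBar_sum {ι : Type*} (s : Finset ι) (f : ι → cs.GenericHecke) :
    cs.heckeBar (∑ z ∈ s, f z) = ∑ z ∈ s, cs.heckeBar (f z) := by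
  classical
  induction s using Finset.induction_on with
  | empty => simp [heckeBar_zero]
  | insert a s ha ih => rw [Finset.sum_insert ha, Finset.sum_insert ha, heckeBar_add, ih]

open Classical in
theorem IsKLElement.exists_simple_mul {u : W} {i : B}
    (hu : cs.length u < cs.length (cs.simple i * u))
    {Cu : cs.GenericHecke} {Pu : W → Polynomial ℤ} (h : cs.IsKLElement u Cu Pu)
    (D : W → cs.GenericHecke) (Q : W → W → Polynomial ℤ)
    (hD : ∀ z, cs.length z ≤ cs.length u → cs.IsKLElement z (D z) (Q z)) :
    ∃ C P, cs.IsKLElement (cs.simple i * u) C P := by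
  have hw : cs.length (cs.simple i * u) = cs.length u + 1 := by
    have := cs.length_simple_mul u i; lia
  set w := cs.simple i * u with hwdef
  have hiw : cs.simple i * w = u := by rw [hwdef, simple_mul_simple_cancel_left]
  -- the elements `z` for which a correction term is needed
  set F : Finset W := {z ∈ ((cs.heckeT laurentV).repr Cu).support |
    cs.length (cs.simple i * z) < cs.length z} with hF
  set m : W → ℤ := fun z => (Pu z).coeff (cs.length u - cs.length z - 1) with hm
  have hPu : ∀ z, Pu z ≠ 0 → cs.BruhatLE z u := fun z hz => by
    by_contra hc; exact hz (h.eq_zero z hc)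
  have hFmem : ∀ z ∈ F, Pu z ≠ 0 ∧ cs.BruhatLE z u ∧ cs.length z < cs.length u ∧
      cs.length (cs.simple i * z) < cs.length z := by
    intro z hz
    rw [hF, Finset.mem_filter, Finsupp.mem_support_iff, h.repr_eq] at hz
    have h1 : Pu z ≠ 0 := fun h0 => hz.1 (by rw [h0, map_zero, mul_zero])
    refine ⟨h1, hPu z h1, ?_, hz.2⟩
    rcases BruhatLE.eq_or_length_lt cs (hPu z h1) with rfl | h2
    · have := hz.2; lia
    · exact h2
  set P0 : W → Polynomial ℤ := fun y =>
    if cs.length (cs.simple i * y) < cs.length y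
    then Pu (cs.simple i * y) + Polynomial.X ^ 2 * Pu y
    else Pu y + Polynomial.X ^ 2 * Pu (cs.simple i * y) with hP0
  set P : W → Polynomial ℤ := fun y => P0 y - ∑ z ∈ F,
    Polynomial.C (m z) * Polynomial.X ^ (cs.length w - cs.length z) * Q z y with hP
  refine ⟨cs.heckeGen laurentV i * Cu + (T (-1) : ℤ[T;T⁻¹]) • Cu -
    ∑ z ∈ F, (LaurentPolynomial.C (m z) : ℤ[T;T⁻¹]) • D z, P, ?_, ?_, ?_, ?_, ?_⟩
  · rw [heckeBar_sub, heckeBar_add, heckeBar_gen_mul, heckeBar_smul, heckeBar_sum, h.bar_eq]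
    congr 1
    · rw [invert_T, sub_mul, ← Algebra.smul_def, val_laurentV, val_inv_laurentV, sub_smul]
      simp only [neg_neg]
      abel
    · refine Finset.sum_congr rfl fun z hz => ?_
      rw [heckeBar_smul, invert_C, (hD z (hFmem z hz).2.2.1.le).bar_eq]
  · intro y
    have hsum : (cs.heckeT laurentV).repr (∑ z ∈ F, (LaurentPolynomial.C (m z) : ℤ[T;T⁻¹]) • D z) y
        = T ((cs.length y : ℤ) - cs.length w) * Polynomial.toLaurent (∑ z ∈ F,
          Polynomial.C (m z) * Polynomial.X ^ (cs.length w - cs.length z) * Q z y) := by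
      rw [map_sum, Finsupp.finsetSum_apply, map_sum, Finset.mul_sum]
      refine Finset.sum_congr rfl fun z hz => ?_
      have hz' := (hFmem z hz).2.2.1
      rw [map_smul, Finsupp.smul_apply, (hD z hz'.le).repr_eq, smul_eq_mul, map_mul, map_mul,
        Polynomial.toLaurent_C, Polynomial.toLaurent_X_pow]
      have : (T ((cs.length y : ℤ) - cs.length z) : ℤ[T;T⁻¹]) =
          T ((cs.length y : ℤ) - cs.length w) * T ((cs.length w - cs.length z : ℕ) : ℤ) := by
        rw [← T_add]; congr 1; lia
      rw [this]; ring
    have hmain : (cs.heckeT laurentV).repr (cs.heckeGen laurentV i * Cu +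
        (T (-1) : ℤ[T;T⁻¹]) • Cu) y =
        T ((cs.length y : ℤ) - cs.length w) * Polynomial.toLaurent (P0 y) := by
      rw [map_add, Finsupp.add_apply, heckeT_repr_gen_mul, map_smul, Finsupp.smul_apply,
        smul_eq_mul, h.repr_eq, h.repr_eq, val_laurentV, val_inv_laurentV]
      have h1 := cs.length_simple_mul y i
      simp only [hP0]
      split_ifs with h2
      · rw [map_add, map_mul, Polynomial.toLaurent_X_pow]
        have e1 : ((cs.length (cs.simple i * y) : ℤ) - cs.length u) =
          (cs.length y : ℤ) - cs.length w := by lia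
        have e2 : (T ((cs.length y : ℤ) - cs.length u) : ℤ[T;T⁻¹]) =
          T ((cs.length y : ℤ) - cs.length w) * T 1 := by rw [← T_add]; congr 1; lia
        have e3 : (T ((2 : ℕ) : ℤ) : ℤ[T;T⁻¹]) = T 1 * T 1 := by rw [← T_add]; rfl
        rw [e1, e2, e3]; ring
      · rw [map_add, map_mul, Polynomial.toLaurent_X_pow]
        have e1 : (T ((cs.length (cs.simple i * y) : ℤ) - cs.length u) : ℤ[T;T⁻¹]) =
          T ((cs.length y : ℤ) - cs.length w) * T ((2 : ℕ) : ℤ) := by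
            rw [← T_add]; congr 1; lia
        have e2 : (T ((cs.length y : ℤ) - cs.length w) : ℤ[T;T⁻¹]) =
          T (-1) * T ((cs.length y : ℤ) - cs.length u) := by rw [← T_add]; congr 1; lia
        rw [e1, e2]; ring
    rw [map_sub, Finsupp.sub_apply, hsum, hmain, hP, map_sub, mul_sub]
  · have h1 : P0 w = 1 := by
      have : Pu w = 0 := h.eq_zero _ fun hc => by
        have := BruhatLE.length_le cs hc; lia
      simp only [hP0]
      rw [if_pos (by rw [hiw]; lia), hiw, h.self_eq, this]; simp
    have h2 : ∀ z ∈ F, Q z w = 0 := fun z hz => by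
      have hz' := (hFmem z hz).2.2.1
      refine (hD z hz'.le).eq_zero _ fun hc => ?_
      have := BruhatLE.length_le cs hc; lia
    simp only [hP]
    rw [h1, Finset.sum_eq_zero (fun z hz => by rw [h2 z hz, mul_zero]), sub_zero]
  · intro y hy
    have huw : cs.BruhatLE u w := cs.bruhatLE_simple_mul i hu
    have h1 : Pu y = 0 := h.eq_zero _ fun hc => hy (BruhatLE.trans cs hc huw)
    have h2 : Pu (cs.simple i * y) = 0 := h.eq_zero _ fun hc => hy (by
      rcases BruhatLE.simple_mul cs i hc with h3 | h3
      · rw [simple_mul_simple_cancel_left] at h3; exact BruhatLE.trans cs h3 huw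
      · rwa [simple_mul_simple_cancel_left] at h3)
    have h3 : ∀ z ∈ F, Q z y = 0 := fun z hz => by
      obtain ⟨_, hz1, hz2, _⟩ := hFmem z hz
      exact (hD z hz2.le).eq_zero _ fun hc =>
        hy (BruhatLE.trans cs hc (BruhatLE.trans cs hz1 huw))
    simp only [hP, hP0]
    rw [h1, h2, Finset.sum_eq_zero (fun z hz => by rw [h3 z hz, mul_zero])]
    simp
  · rintro y ⟨hyw, hne⟩
    have hlen : cs.length y < cs.length w :=
      (BruhatLE.eq_or_length_lt cs hyw).resolve_left hne
    have h1 := cs.length_simple_mul y i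
    rw [Polynomial.degree_lt_iff_coeff_zero]
    intro n hn
    -- degree bounds for the polynomials of `u`
    have hdeg : ∀ x, ∀ k, x ≠ u → cs.length u - cs.length x ≤ k → (Pu x).coeff k = 0 := by
      intro x k hx hk
      exact Polynomial.coeff_eq_zero_of_degree_lt
        (lt_of_lt_of_le (h.degree_lt' cs hx) (by exact_mod_cast hk))
    have hQ : ∀ z ∈ F, z ≠ y → ∀ k, cs.length z - cs.length y ≤ k → (Q z y).coeff k = 0 := by
      intro z hz hzy k hk
      exact Polynomial.coeff_eq_zero_of_degree_lt
        (lt_of_lt_of_le ((hD z (hFmem z hz).2.2.1.le).degree_lt' cs hzy.symm)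
          (by exact_mod_cast hk))
    have hterm : ∀ z ∈ F, z ≠ y → (Polynomial.C (m z) *
        Polynomial.X ^ (cs.length w - cs.length z) * Q z y).coeff n = 0 := by
      intro z hz hzy
      have hz' := (hFmem z hz).2.2.1
      by_cases hyz : cs.BruhatLE y z
      · have := BruhatLE.length_le cs hyz
        rw [mul_assoc, Polynomial.coeff_C_mul, Polynomial.coeff_X_pow_mul', if_pos (by lia),
          hQ z hz hzy _ (by lia), mul_zero]
      · rw [(hD z hz'.le).eq_zero y hyz]; simp
    simp only [hP]
    rw [Polynomial.coeff_sub, Polynomial.finsetSum_coeff]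
    by_cases h2 : cs.length (cs.simple i * y) < cs.length y
    · have hyu : y ≠ u := by rintro rfl; rw [← hwdef] at h2; lia
      have hsyu : cs.simple i * y ≠ u := by
        intro hc; apply hne; rw [hwdef, ← hc, simple_mul_simple_cancel_left]
      have e0 : (P0 y).coeff n = if n = cs.length w - cs.length y then m y else 0 := by
        simp only [hP0, if_pos h2]
        rw [Polynomial.coeff_add, hdeg _ _ hsyu (by lia), zero_add, Polynomial.coeff_X_pow_mul']
        split_ifs with h3 h4 h4
        · simp only [hm]; congr 1; lia
        · exact hdeg _ _ hyu (by lia)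
        · exact (hdeg _ _ hyu (by lia)).symm
        · rfl
      have e1 : ∑ z ∈ F, (Polynomial.C (m z) * Polynomial.X ^ (cs.length w - cs.length z) *
          Q z y).coeff n = if n = cs.length w - cs.length y then m y else 0 := by
        by_cases hyF : y ∈ F
        · rw [Finset.sum_eq_single y (fun z hz hzy => hterm z hz hzy)
            (fun hc => absurd hyF hc), (hD y (hFmem y hyF).2.2.1.le).self_eq, mul_one,
            Polynomial.coeff_C_mul_X_pow]
        · rw [Finset.sum_eq_zero fun z hz => hterm z hz (by rintro rfl; exact hyF hz)]
          have : Pu y = 0 := by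
            by_contra hc
            apply hyF
            rw [hF, Finset.mem_filter, Finsupp.mem_support_iff, h.repr_eq]
            refine ⟨fun h0 => hc ?_, h2⟩
            rw [IsUnit.mul_right_eq_zero (isUnit_T _)] at h0
            simpa using h0
          simp [hm, this]
      rw [e0, e1, sub_self]
    · rw [Finset.sum_eq_zero fun z hz => hterm z hz
        (by rintro rfl; exact h2 (hFmem z hz).2.2.2), sub_zero]
      simp only [hP0, if_neg h2]
      rw [Polynomial.coeff_add, Polynomial.coeff_X_pow_mul']
      have e2 : (Pu y).coeff n = 0 := by
        by_cases hyu : y = u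
        · rw [hyu, h.self_eq, Polynomial.coeff_one, if_neg (by subst hyu; lia)]
        · exact hdeg _ _ hyu (by lia)
      rw [e2, zero_add]
      split_ifs with h3
      · refine hdeg _ _ ?_ (by lia)
        intro hc; apply hne; rw [hwdef, ← hc, simple_mul_simple_cancel_left]
      · rfl

/-- The existence of the Kazhdan–Lusztig basis. -/
theorem exists_isKLElement (w : W) : ∃ C P, cs.IsKLElement w C P := by
  classical
  induction hn : cs.length w using Nat.strong_induction_on generalizing w with
  | _ n ih =>
    by_cases hw : w = 1
    · subst hw; exact ⟨_, _, cs.isKLElement_one⟩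
    · obtain ⟨i, hi⟩ := cs.exists_leftDescent_of_ne_one hw
      have hi' : cs.length (cs.simple i * w) < cs.length w := hi
      obtain ⟨Cu, Pu, hu⟩ := ih _ (hn ▸ hi') (cs.simple i * w) rfl
      have hD : ∀ z, ∃ (D : cs.GenericHecke) (Q : W → Polynomial ℤ),
          cs.length z ≤ cs.length (cs.simple i * w) → cs.IsKLElement z D Q := by
        intro z
        by_cases hz : cs.length z ≤ cs.length (cs.simple i * w)
        · obtain ⟨D, Q, h⟩ := ih (cs.length z) (by lia) z rfl
          exact ⟨D, Q, fun _ => h⟩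
        · exact ⟨0, 0, fun h => absurd h hz⟩
      choose D Q hDQ using hD
      have := hu.exists_simple_mul cs (i := i) (by rwa [simple_mul_simple_cancel_left]) D Q hDQ
      rwa [simple_mul_simple_cancel_left] at this

end KazhdanLusztigExistence

end CoxeterSystem
namespace CoxeterSystem

section Cells

variable {B W : Type*} [Group W] {M : CoxeterMatrix B} (cs : CoxeterSystem M W)

/-- The Kazhdan–Lusztig basis element `C'_w` of the generic Iwahori–Hecke algebra. -/
noncomputable def klBasisElt (w : W) : cs.GenericHecke := (cs.exists_isKLElement w).choose

/-- The Kazhdan–Lusztig polynomial `P_{y,w} ∈ ℤ[v]`, so that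
`C'_w = ∑_y v ^ (ℓ y - ℓ w) P_{y,w} T_y`. -/
noncomputable def klPoly (y w : W) : Polynomial ℤ := (cs.exists_isKLElement w).choose_spec.choose y

theorem isKLElement_klPoly (w : W) :
    cs.IsKLElement w (cs.klBasisElt w) (fun y => cs.klPoly y w) :=
  (cs.exists_isKLElement w).choose_spec.choose_spec

open Classical in
/-- `μ(y, w)`: the coefficient of `v ^ (ℓ w - ℓ y - 1)` in `P_{y,w}` if `y < w`
(and `0` by convention otherwise). -/
noncomputable def klMu (y w : W) : ℤ :=
  if cs.BruhatLT y w then (cs.klPoly y w).coeff (cs.length w - cs.length y - 1) else 0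

open Classical in
/-- The symmetrised coefficient: `μ(x, y)` if `x < y`, `μ(y, x)` if `y < x`, and `0` otherwise. -/
noncomputable def klMuSymm (x y : W) : ℤ :=
  if cs.BruhatLT x y then cs.klMu x y else if cs.BruhatLT y x then cs.klMu y x else 0

/-- The elementary relation `y ←_L w`: either `y = w`, or `y < w`, `μ(y, w) ≠ 0` and there is some
`s ∈ S` with `s y < y` and `s w > w`, or `y = s w > w` for some `s ∈ S`. -/
def KLArrow (y w : W) : Prop :=
  y = w ∨
  (cs.BruhatLT y w ∧ cs.klMu y w ≠ 0 ∧
    ∃ i : B, cs.length (cs.simple i * y) < cs.length y ∧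
      cs.length w < cs.length (cs.simple i * w)) ∨
  ∃ i : B, y = cs.simple i * w ∧ cs.length w < cs.length (cs.simple i * w)

/-- The Kazhdan–Lusztig left pre-order `x ≤_L y`. -/
def LeftLE (x y : W) : Prop := Relation.ReflTransGen cs.KLArrow x y

/-- The equivalence relation `x ∼_L y`. -/
def LeftEquiv (x y : W) : Prop := cs.LeftLE x y ∧ cs.LeftLE y x

/-- The right pre-order `x ≤_R y`. -/
def RightLE (x y : W) : Prop := cs.LeftLE x⁻¹ y⁻¹

/-- The two-sided pre-order `x ≤_{LR} y`. -/
def TwoSidedLE (x y : W) : Prop :=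
  Relation.ReflTransGen (fun a b => cs.LeftLE a b ∨ cs.RightLE a b) x y

/-- The equivalence relation `x ∼_{LR} y`. -/
def TwoSidedEquiv (x y : W) : Prop := cs.TwoSidedLE x y ∧ cs.TwoSidedLE y x

/-- The left cells of `W`: the equivalence classes of `∼_L`. -/
def IsLeftCell (Γ : Set W) : Prop := ∃ x, Γ = {y | cs.LeftEquiv y x}

/-- The two-sided cells of `W`: the equivalence classes of `∼_{LR}`. -/
def IsTwoSidedCell (F : Set W) : Prop := ∃ x, F = {y | cs.TwoSidedEquiv y x}

open Classical in
/-- The action of `T_s` on the left cell module `[Γ]` over `R` with parameter `v ∈ Rˣ`, which is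
free over `R` with basis `e_y` (`y ∈ Γ`): `T_s e_y = -v⁻¹ e_y` if `s y < y`, and
`T_s e_y = v e_y + ∑_{x ∈ Γ, s x < x} μ̃(x, y) e_x` if `s y > y`.  (For finite `W` the sum is
finite.) -/
noncomputable def leftCellOp {R : Type*} [CommRing R] (v : Rˣ) (Γ : Set W) (i : B) :
    Module.End R (Γ →₀ R) :=
  Finsupp.linearCombination R fun y : Γ =>
    if cs.length (cs.simple i * (y : W)) < cs.length (y : W)
    then Finsupp.single y (-((v⁻¹ : Rˣ) : R))
    else Finsupp.single y (v : R) + ∑ᶠ x : Γ,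
      if cs.length (cs.simple i * (x : W)) < cs.length (x : W)
      then Finsupp.single x ((cs.klMuSymm (x : W) (y : W) : ℤ) : R) else 0

variable {E : Type*} [AddCommGroup E] [Module ℝ E]

/-- The irreducible representation `E` of `W` is a constituent of `[Γ]_1`, the `ℝ[W]`-module
obtained from the left cell module by `v ↦ 1`, i.e. `m(Γ, E) > 0`.  As `ℝ[W]` is semisimple for
finite `W`, this says that there is a nonzero `W`-equivariant map `E → [Γ]_1`; equivariance is
tested on the generators. -/
def IsConstituentOfLeftCell (ρ : Representation ℝ W E) (Γ : Set W) : Prop :=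
  ∃ f : E →ₗ[ℝ] (Γ →₀ ℝ), f ≠ 0 ∧
    ∀ (i : B) (e : E), f (ρ (cs.simple i) e) = cs.leftCellOp (1 : ℝˣ) Γ i (f e)

/-- The two-sided cell `F_E` attached to the irreducible representation `E`, given by its elements:
`w ∈ F_E` if `w` lies in a two-sided cell which contains all the (and at least one) left cells `Γ`
such that `E` is a constituent of `[Γ]_1`. -/
def cellOf (ρ : Representation ℝ W E) : Set W :=
  {w | ∃ F, cs.IsTwoSidedCell F ∧ w ∈ F ∧
    (∃ Γ, cs.IsLeftCell Γ ∧ cs.IsConstituentOfLeftCell ρ Γ) ∧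
    ∀ Γ, cs.IsLeftCell Γ → cs.IsConstituentOfLeftCell ρ Γ → Γ ⊆ F}

/-- The indeterminate `v` as a unit of the field `K = ℝ(v)`. -/
noncomputable def ratV : (RatFunc ℝ)ˣ := Units.mk0 RatFunc.X RatFunc.X_ne_zero

/-- The Iwahori–Hecke algebra `H_K` over `K = ℝ(v)`. -/
abbrev HeckeK : Type _ := cs.Hecke ratV

section Character

variable (V : Type*) [AddCommGroup V] [Module (RatFunc ℝ) V] [Module cs.HeckeK V]
  [IsScalarTower (RatFunc ℝ) cs.HeckeK V]

/-- The trace of `T_w` on the `H_K`-module `V`. -/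
noncomputable def heckeTrace (w : W) : RatFunc ℝ :=
  LinearMap.trace (RatFunc ℝ) V (Algebra.lsmul (RatFunc ℝ) (RatFunc ℝ) V (cs.heckeT ratV w))

/-- `V` is the irreducible `H_K`-module `E_v` corresponding to the irreducible representation `E`
of `W` under `v ↦ 1`: it is simple, and for every `w ∈ W` the trace of `T_w` on `V` is defined at
`v = 1`, with value the trace of `w` on `E`. -/
def IsGenericDeformation (ρ : Representation ℝ W E) : Prop :=
  IsSimpleModule cs.HeckeK V ∧ ∀ w : W,
    (cs.heckeTrace V w).denom.eval 1 ≠ 0 ∧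
    (cs.heckeTrace V w).eval (RingHom.id ℝ) 1 = LinearMap.trace ℝ E (ρ w)

/-- The invariant `a_E`, for `V = E_v`: the least `n ≥ 0` such that `v ^ n * trace(T_w, E_v)`
belongs to `ℝ[v]` for all `w ∈ W`. -/
noncomputable def aInvariant : ℕ :=
  sInf {n : ℕ | ∀ w : W, ∃ f : Polynomial ℝ,
    RatFunc.X ^ n * cs.heckeTrace V w = algebraMap (Polynomial ℝ) (RatFunc ℝ) f}

/-- The leading coefficient `c_{w,E}`, for `V = E_v`: the constant coefficient of the polynomial
`(-1) ^ (ℓ w) v ^ (a_E) trace(T_w, E_v) ∈ ℝ[v]`. -/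
noncomputable def leadingCoeff (w : W) : ℝ :=
  (-1) ^ cs.length w * (RatFunc.X ^ cs.aInvariant V * cs.heckeTrace V w).num.coeff 0

end Character

end Cells

end CoxeterSystem

/-!
Let `C_w` be the image of the Kazhdan–Lusztig basis element `C'_w` under `v ↦ -v⁻¹`.  The left
cell module `[Γ]` over `K = ℝ(v)` is the subquotient of `H_K` with basis the `C_y`, `y ∈ Γ`; its
specialisation at `v = 1` is `[Γ]_1`.  Let `Γ` be the left cell of `w`.  The argument compares the
behaviour of `E_v` at the two places `v = 0` and `v = 1`.

*The place `v = 0`.*  The basis `T_w` is orthonormal for a symmetric bilinear form on `H_K` for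
which `T_s` is self-adjoint.  As `K` is formally real, the form is anisotropic, so the annihilator
of `E_v` has an orthogonal complement, generated by a central idempotent `e` whose left
multiplication is self-adjoint (`exists_selfAdjoint_complement`).  In the basis `T_w` the matrix of
`e` is thus symmetric and idempotent; its diagonal entries are the sums of squares of the entries
in their columns.  In such sums leading terms at `v = 0` do not cancel, whence all entries are
regular at `v = 0`, and a column vanishes at `v = 0` as soon as its diagonal entry does.  The bases
`C_w` and `T_w` agree modulo `v`, so at `v = 0` the matrices of `e` in the two bases coincide.  If
`E_v` does not occur in `[Γ]`, then `e` acts as zero on `[Γ]`; in particular the coefficient of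
`C_w` in `e C_w` is zero, and all coefficients of `e T_w` vanish at `v = 0`
(`ratVal_repr_idempotent_mul_pos`).  Since `e` acts as the identity on `E_v`, the polynomial
`v ^ a_E trace(T_w, E_v)` is the combination, with these coefficients, of the polynomials
`v ^ a_E trace(T_y, E_v)`, and its constant coefficient is zero
(`leadingCoeff_eq_zero_of_ratVal_repr_pos`).  So `c_{w,E} ≠ 0` forces `E_v` to occur in `[Γ]`.

*The place `v = 1`.*  If `E_v` embeds into `[Γ]`, its vectors with polynomial coordinates form a
lattice which is stable under all `v ^ (ℓ w) T_w`, and which is pure, so that its reduction at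
`v = 1` embeds into `[Γ]_1` (`exists_polynomial_basis`).  The reduction has the character of `E`,
so `E` occurs in `[Γ]_1` (`isConstituentOfLeftCell_of_isGenericDeformation`).

*Two-sided cells.*  If `E` occurs in `[Γ]_1` and in `[Γ']_1`, some `C_y` with `y ≤_L Γ` acts
nontrivially on `E`, hence on `[Γ']_1`; a basis element which occurs in a product `C_y C_z` then
shows `Γ' ≤_R y ≤_L Γ` (`twoSidedLE_of_isConstituentOfLeftCell`).  By symmetry the two-sided cell
`F_E` is well defined and contains every left cell in which `E` occurs, in particular that of `w`.
-/

namespace CoxeterSystem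

/-! ### The Hecke algebra: anti-involution and symmetric form -/

section HeckeGeneral

variable {B W : Type*} [Group W] {M : CoxeterMatrix B} (cs : CoxeterSystem M W)
  {R : Type*} [CommRing R] (v : Rˣ)

theorem heckeGen_mul_heckeT_of_lt (i : B) (w : W)
    (h : cs.length w < cs.length (cs.simple i * w)) :
    cs.heckeGen v i * cs.heckeT v w = cs.heckeT v (cs.simple i * w) := by
  rw [heckeGen_mul_heckeT, if_neg (by lia), add_zero]

/-- Induction on elements of the Hecke algebra through left multiplication by the generators. -/
theorem hecke_gen_induction {p : cs.Hecke v → Prop} (h : cs.Hecke v) (one : p 1)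
    (gen : ∀ i a, p a → p (cs.heckeGen v i * a)) (zero : p 0)
    (add : ∀ a b, p a → p b → p (a + b)) (smul : ∀ (r : R) a, p a → p (r • a)) : p h := by
  have hT : ∀ w, p (cs.heckeT v w) := by
    intro w
    induction hn : cs.length w generalizing w with
    | zero =>
      rw [cs.length_eq_zero_iff] at hn
      rwa [hn, heckeT_one]
    | succ n ih =>
      have hw : w ≠ 1 := by rintro rfl; simp at hn
      obtain ⟨i, hi⟩ := cs.exists_leftDescent_of_ne_one hw
      have hi' : cs.length (cs.simple i * w) < cs.length w := hi
      have h1 := cs.length_simple_mul w i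
      have h2 := cs.heckeGen_mul_heckeT_of_lt v i (cs.simple i * w)
        (by rwa [simple_mul_simple_cancel_left])
      rw [simple_mul_simple_cancel_left] at h2
      rw [← h2]
      exact gen _ _ (ih _ (by lia))
  have := (cs.heckeT v).mem_span h
  induction this using Submodule.span_induction with
  | mem x hx => obtain ⟨w, rfl⟩ := hx; exact hT w
  | zero => exact zero
  | add a b _ _ ha hb => exact add _ _ ha hb
  | smul r a _ ha => exact smul _ _ ha

open Classical in
/-- The right-handed multiplication rule of the Hecke algebra. -/
theorem heckeT_mul_heckeGen (w : W) (i : B) :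
    cs.heckeT v w * cs.heckeGen v i = cs.heckeT v (w * cs.simple i) +
      if cs.length (w * cs.simple i) < cs.length w
      then ((v : R) - ((v⁻¹ : Rˣ) : R)) • cs.heckeT v w else 0 := by
  split_ifs with h
  · have h1 := cs.heckeT_mul_gen v (w * cs.simple i) i (by rwa [simple_mul_simple_cancel_right])
    rw [simple_mul_simple_cancel_right] at h1
    rw [h1, mul_assoc, heckeGen_mul_self, mul_add, mul_one, mul_smul_comm]
  · have := cs.length_mul_simple_ne w i
    rw [add_zero, heckeT_mul_gen _ _ _ _ (by lia)]

/-- The `R`-linear anti-involution `T_w ↦ T_{w⁻¹}` of the Hecke algebra. -/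
noncomputable def heckeStar : cs.Hecke v →ₗ[R] cs.Hecke v :=
  (cs.heckeT v).constr R fun w => cs.heckeT v w⁻¹

theorem heckeStar_heckeT (w : W) : cs.heckeStar v (cs.heckeT v w) = cs.heckeT v w⁻¹ :=
  (cs.heckeT v).constr_basis R _ w

theorem heckeStar_one : cs.heckeStar v 1 = 1 := by
  rw [← heckeT_one, heckeStar_heckeT, inv_one]

theorem heckeStar_heckeStar (h : cs.Hecke v) : cs.heckeStar v (cs.heckeStar v h) = h := by
  have : (cs.heckeStar v).comp (cs.heckeStar v) = LinearMap.id :=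
    (cs.heckeT v).ext fun w => by simp [heckeStar_heckeT]
  exact LinearMap.congr_fun this h

theorem heckeStar_repr (h : cs.Hecke v) (y : W) :
    (cs.heckeT v).repr (cs.heckeStar v h) y = (cs.heckeT v).repr h y⁻¹ := by
  classical
  have : (Finsupp.lapply y).comp ((cs.heckeT v).repr.toLinearMap.comp (cs.heckeStar v)) =
      (Finsupp.lapply y⁻¹).comp (cs.heckeT v).repr.toLinearMap :=
    (cs.heckeT v).ext fun w => by
      simp [heckeStar_heckeT, Finsupp.single_apply, inv_eq_iff_eq_inv]
  exact LinearMap.congr_fun this h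

theorem heckeStar_gen_mul (i : B) (h : cs.Hecke v) :
    cs.heckeStar v (cs.heckeGen v i * h) = cs.heckeStar v h * cs.heckeGen v i := by
  classical
  have : (cs.heckeStar v).comp (LinearMap.mulLeft R (cs.heckeGen v i)) =
      (LinearMap.mulRight R (cs.heckeGen v i)).comp (cs.heckeStar v) := by
    refine (cs.heckeT v).ext fun w => ?_
    have hl : cs.length (w⁻¹ * cs.simple i) = cs.length (cs.simple i * w) := by
      rw [← cs.length_inv]; simp
    simp only [LinearMap.comp_apply, LinearMap.mulLeft_apply, LinearMap.mulRight_apply,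
      heckeGen_mul_heckeT, heckeStar_heckeT, heckeT_mul_heckeGen, map_add, hl, cs.length_inv,
      mul_inv_rev, inv_simple]
    split_ifs <;> simp [heckeStar_heckeT]
  exact LinearMap.congr_fun this h

theorem heckeStar_mul (h k : cs.Hecke v) :
    cs.heckeStar v (h * k) = cs.heckeStar v k * cs.heckeStar v h := by
  induction h using cs.hecke_gen_induction v with
  | one => rw [one_mul, heckeStar_one, mul_one]
  | gen i a ha => rw [mul_assoc, heckeStar_gen_mul, ha, heckeStar_gen_mul, mul_assoc]
  | zero => simp
  | add a b ha hb => rw [add_mul, map_add, ha, hb, map_add, mul_add]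
  | smul r a ha => rw [smul_mul_assoc, map_smul, ha, map_smul, mul_smul_comm]

section Form

variable [Fintype W]

/-- The symmetric bilinear form on the Hecke algebra for which the basis `T_w` is orthonormal. -/
noncomputable def heckeForm : LinearMap.BilinForm R (cs.Hecke v) :=
  ∑ w, LinearMap.BilinForm.linMulLin ((cs.heckeT v).coord w) ((cs.heckeT v).coord w)

theorem heckeForm_apply (h k : cs.Hecke v) :
    cs.heckeForm v h k = ∑ w, (cs.heckeT v).repr h w * (cs.heckeT v).repr k w := by
  simp [heckeForm]

theorem heckeForm_comm (h k : cs.Hecke v) : cs.heckeForm v h k = cs.heckeForm v k h := by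
  simp only [heckeForm_apply, mul_comm]

theorem heckeForm_heckeT_left (w : W) (h : cs.Hecke v) :
    cs.heckeForm v (cs.heckeT v w) h = (cs.heckeT v).repr h w := by
  classical
  simp [heckeForm_apply, Finsupp.single_apply]

theorem heckeForm_gen_mul (i : B) (h k : cs.Hecke v) :
    cs.heckeForm v (cs.heckeGen v i * h) k = cs.heckeForm v h (cs.heckeGen v i * k) := by
  classical
  simp only [heckeForm_apply, heckeT_repr_gen_mul, add_mul, mul_add, Finset.sum_add_distrib]
  congr 1
  · refine Fintype.sum_equiv (Equiv.mulLeft (cs.simple i)) _ _ fun w => ?_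
    simp
  · refine Finset.sum_congr rfl fun w _ => ?_
    split_ifs <;> ring

theorem heckeForm_star_star (h k : cs.Hecke v) :
    cs.heckeForm v (cs.heckeStar v h) (cs.heckeStar v k) = cs.heckeForm v h k := by
  simp only [heckeForm_apply, heckeStar_repr]
  exact Fintype.sum_equiv (Equiv.inv W) _ _ fun w => rfl

theorem heckeForm_star_mul (h x y : cs.Hecke v) :
    cs.heckeForm v (cs.heckeStar v h * x) y = cs.heckeForm v x (h * y) := by
  induction h using cs.hecke_gen_induction v generalizing x y with
  | one => rw [heckeStar_one, one_mul, one_mul]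
  | gen i a ha => rw [heckeStar_gen_mul, mul_assoc, ha, heckeForm_gen_mul, ← mul_assoc]
  | zero => simp
  | add a b ha hb => simp [add_mul, ha, hb]
  | smul r a ha => simp [ha]

theorem heckeForm_mul_star (h x y : cs.Hecke v) :
    cs.heckeForm v (x * cs.heckeStar v h) y = cs.heckeForm v x (y * h) := by
  rw [← heckeForm_star_star, heckeStar_mul, heckeForm_star_mul, ← heckeForm_star_star,
    heckeStar_heckeStar, heckeStar_mul, heckeStar_heckeStar, heckeStar_heckeStar]

end Form

end HeckeGeneral

section HeckeIdempotent

variable {B W : Type*} [Group W] [Fintype W] {M : CoxeterMatrix B} (cs : CoxeterSystem M W)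
  {K : Type*} [Field K] (v : Kˣ)

/-- For a two-sided ideal `N` of the Hecke algebra over a field in which a sum of squares vanishes
only trivially, the orthogonal complement of `N` is generated by an idempotent `e`, whose left
multiplication is self-adjoint for the form with orthonormal basis `T_w`. -/
theorem exists_selfAdjoint_complement (hK : ∀ f : W → K, ∑ w, f w * f w = 0 → ∀ w, f w = 0)
    (N : Submodule K (cs.Hecke v)) (hl : ∀ h, ∀ n ∈ N, h * n ∈ N) (hr : ∀ h, ∀ n ∈ N, n * h ∈ N) :
    ∃ e : cs.Hecke v, 1 - e ∈ N ∧ (∀ n ∈ N, n * e = 0 ∧ e * n = 0) ∧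
      ∀ x y, cs.heckeForm v (e * x) y = cs.heckeForm v x (e * y) := by
  have hfd : FiniteDimensional K (cs.Hecke v) := Module.Finite.of_basis (cs.heckeT v)
  have haniso : ∀ x, cs.heckeForm v x x = 0 → x = 0 := by
    intro x hx
    rw [heckeForm_apply] at hx
    apply (cs.heckeT v).ext_elem
    intro w
    rw [hK _ hx w, map_zero]; rfl
  have hrefl : (cs.heckeForm v).IsRefl := fun x y h => by rw [heckeForm_comm, h]
  have hdisj : Disjoint N ((cs.heckeForm v).orthogonal N) := by
    rw [Submodule.disjoint_def]
    intro x hx hx'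
    exact haniso x (hx' x hx)
  have hcompl : IsCompl N ((cs.heckeForm v).orthogonal N) :=
    (LinearMap.BilinForm.isCompl_orthogonal_iff_disjoint hrefl).2 hdisj
  have hol : ∀ h, ∀ x ∈ (cs.heckeForm v).orthogonal N,
      h * x ∈ (cs.heckeForm v).orthogonal N := by
    intro h x hx n hn
    change cs.heckeForm v n (h * x) = 0
    rw [← heckeForm_star_mul]
    exact hx _ (hl _ _ hn)
  have hor : ∀ h, ∀ x ∈ (cs.heckeForm v).orthogonal N,
      x * h ∈ (cs.heckeForm v).orthogonal N := by
    intro h x hx n hn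
    change cs.heckeForm v n (x * h) = 0
    rw [← heckeForm_mul_star]
    exact hx _ (hr _ _ hn)
  obtain ⟨n, hn, e, he, hne⟩ : ∃ n ∈ N, ∃ e ∈ (cs.heckeForm v).orthogonal N, n + e = 1 :=
    Submodule.mem_sup.1 (by rw [hcompl.sup_eq_top]; trivial)
  have hn1 : 1 - e = n := by rw [← hne, add_sub_cancel_right]
  refine ⟨e, hn1 ▸ hn, fun n' hn' => ⟨?_, ?_⟩, fun x y => ?_⟩
  · exact Submodule.disjoint_def.1 hdisj _ (hr _ _ hn') (hol _ _ he)
  · exact Submodule.disjoint_def.1 hdisj _ (hl _ _ hn') (hor _ _ he)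
  · have key : ∀ x y, cs.heckeForm v (e * x) y = cs.heckeForm v (e * x) (e * y) := by
      intro x y
      have h1 : cs.heckeForm v (e * x) (n * y) = 0 := by
        rw [heckeForm_comm]
        exact hor x e he _ (hr y n hn)
      have h2 : y = n * y + e * y := by rw [← add_mul, hne, one_mul]
      conv_lhs => rw [h2, map_add, h1, zero_add]
    rw [key x y, heckeForm_comm cs v x, key y x, heckeForm_comm]

end HeckeIdempotent

/-! ### Multiplication of the Kazhdan–Lusztig basis by the generators -/

section KLMultiplication

open LaurentPolynomial

variable {B W : Type*} [Group W] {M : CoxeterMatrix B} (cs : CoxeterSystem M W)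

/-- The coefficient `p_{y,w} ∈ ℤ[v⁻¹]` of `T_y` in the Kazhdan–Lusztig element `C'_w`. -/
noncomputable def klCoeff (y w : W) : ℤ[T;T⁻¹] := (cs.heckeT laurentV).repr (cs.klBasisElt w) y

theorem klBasisElt_repr (y w : W) :
    (cs.heckeT laurentV).repr (cs.klBasisElt w) y = cs.klCoeff y w := rfl

theorem klCoeff_self (w : W) : cs.klCoeff w w = 1 := by
  rw [klCoeff, (cs.isKLElement_klPoly w).repr_eq, (cs.isKLElement_klPoly w).self_eq]; simp

theorem klCoeff_coeff_of_ne {y w : W} (h : y ≠ w) (n : ℤ) (hn : 0 ≤ n) :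
    (cs.klCoeff y w).coeff n = 0 :=
  (cs.isKLElement_klPoly w).coeff_eq_zero cs h n hn

open Classical in
theorem klCoeff_coeff_of_nonneg (y w : W) (n : ℤ) (hn : 0 ≤ n) :
    (cs.klCoeff y w).coeff n = if y = w ∧ n = 0 then 1 else 0 := by
  by_cases h : y = w
  · subst h
    rw [klCoeff_self, ← T_zero, T_apply]
    simp [eq_comm]
  · rw [klCoeff_coeff_of_ne cs h n hn]; simp [h]

theorem klMu_eq_zero_of_not_lt {y w : W} (h : ¬ cs.BruhatLT y w) : cs.klMu y w = 0 := if_neg h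

theorem length_lt_of_klMu_ne_zero {y w : W} (h : cs.klMu y w ≠ 0) :
    cs.length y < cs.length w := by
  by_contra hc
  refine h (klMu_eq_zero_of_not_lt cs fun hlt => hc ?_)
  exact (BruhatLE.eq_or_length_lt cs hlt.1).resolve_left hlt.2

theorem klCoeff_coeff_neg_one (y w : W) : (cs.klCoeff y w).coeff (-1) = cs.klMu y w := by
  by_cases h : y = w
  · subst h
    rw [klCoeff_self, klMu_eq_zero_of_not_lt cs fun h => h.2 rfl, ← T_zero, T_apply,
      if_neg (by lia)]
  · by_cases hle : cs.BruhatLE y w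
    · have hl := (BruhatLE.eq_or_length_lt cs hle).resolve_left h
      rw [klCoeff, (cs.isKLElement_klPoly w).repr_eq, coeff_T_mul, klMu, if_pos ⟨hle, h⟩,
        show (-1 - ((cs.length y : ℤ) - cs.length w)) =
          ((cs.length w - cs.length y - 1 : ℕ) : ℤ) by lia]
      exact toLaurent_coeff_natCast _ _
    · rw [klCoeff, (cs.isKLElement_klPoly w).repr_eq, (cs.isKLElement_klPoly w).eq_zero y hle,
        klMu_eq_zero_of_not_lt cs fun h => hle h.1]
      simp

theorem heckeBar_heckeStar (h : cs.GenericHecke) :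
    cs.heckeBar (cs.heckeStar laurentV h) = cs.heckeStar laurentV (cs.heckeBar h) := by
  induction h using cs.hecke_induction with
  | zero => simp [heckeBar_zero]
  | add a b ha hb => rw [map_add, heckeBar_add, ha, hb, heckeBar_add, map_add]
  | smul r a ha => rw [map_smul, heckeBar_smul, ha, heckeBar_smul, map_smul]
  | basis w =>
    rw [heckeStar_heckeT, heckeBar_heckeT, heckeBar_heckeT, inv_inv]
    refine (cs.isUnit_heckeT laurentV w).mul_left_cancel ?_
    rw [Ring.mul_inverse_cancel _ (cs.isUnit_heckeT laurentV w),
      show cs.heckeT laurentV w = cs.heckeStar laurentV (cs.heckeT laurentV w⁻¹) by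
        rw [heckeStar_heckeT, inv_inv], ← heckeStar_mul,
      Ring.inverse_mul_cancel _ (cs.isUnit_heckeT laurentV w⁻¹), heckeStar_one]

theorem BruhatLE.inv {x y : W} (h : cs.BruhatLE x y) : cs.BruhatLE x⁻¹ y⁻¹ := by
  induction h with
  | refl => exact Relation.ReflTransGen.refl
  | @tail a b _ h ih =>
    obtain ⟨t, ht, rfl, hl⟩ := h
    refine ih.tail ⟨a * t * a⁻¹, ht.conj a, ?_, by simpa only [cs.length_inv] using hl⟩
    rw [mul_inv_rev, ht.inv]; group

/-- The anti-involution `T_w ↦ T_{w⁻¹}` sends `C'_w` to `C'_{w⁻¹}`. -/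
theorem heckeStar_klBasisElt (w : W) :
    cs.heckeStar laurentV (cs.klBasisElt w) = cs.klBasisElt w⁻¹ := by
  have h := cs.isKLElement_klPoly w
  refine (IsKLElement.unique cs (P := fun y => cs.klPoly y⁻¹ w)
    ⟨?_, fun y => ?_, ?_, fun y hy => ?_, fun y hy => ?_⟩ (cs.isKLElement_klPoly w⁻¹)).1
  · rw [heckeBar_heckeStar, h.bar_eq]
  · rw [heckeStar_repr, h.repr_eq, cs.length_inv, cs.length_inv]
  · rw [inv_inv]; exact h.self_eq
  · exact h.eq_zero _ fun hc => hy (by simpa using BruhatLE.inv cs hc)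
  · have := h.degree_lt y⁻¹ ⟨by simpa using BruhatLE.inv cs hy.1,
      fun hc => hy.2 (by rw [← hc, inv_inv])⟩
    simpa only [cs.length_inv] using this

theorem klCoeff_inv (y w : W) : cs.klCoeff y⁻¹ w⁻¹ = cs.klCoeff y w := by
  rw [klCoeff, ← heckeStar_klBasisElt, heckeStar_repr, inv_inv, klCoeff]

variable [Fintype W]

open Classical in
/-- Left multiplication of `C'_u` by `C'_s = T_s + v⁻¹` if `s u > u`, in terms of `μ`. -/
theorem heckeGen_mul_klBasisElt_of_lt_aux {u : W} {i : B}
    (hu : cs.length u < cs.length (cs.simple i * u)) :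
    cs.heckeGen laurentV i * cs.klBasisElt u + (T (-1) : ℤ[T;T⁻¹]) • cs.klBasisElt u =
      cs.klBasisElt (cs.simple i * u) +
        ∑ z with cs.length (cs.simple i * z) < cs.length z,
          (LaurentPolynomial.C (cs.klMu z u) : ℤ[T;T⁻¹]) • cs.klBasisElt z := by
  have hb : ∀ z, cs.heckeBar (cs.klBasisElt z) = cs.klBasisElt z :=
    fun z => (cs.isKLElement_klPoly z).bar_eq
  -- the difference of the two sides is fixed by the bar involution and has coefficients in
  -- `v⁻¹ ℤ[v⁻¹]`, so it vanishes
  rw [← sub_eq_zero]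
  apply cs.eq_zero_of_heckeBar_eq
  · rw [heckeBar_sub, heckeBar_add, heckeBar_gen_mul, heckeBar_smul, heckeBar_add, heckeBar_sum,
      hb, hb]
    congr 1
    · rw [invert_T, sub_mul, ← Algebra.smul_def, val_laurentV, val_inv_laurentV, sub_smul]
      simp only [neg_neg]
      abel
    · congr 1
      refine Finset.sum_congr rfl fun z _ => ?_
      rw [heckeBar_smul, invert_C, hb]
  · intro y n hn
    have hsum : ((cs.heckeT laurentV).repr
        (∑ z with cs.length (cs.simple i * z) < cs.length z,
          (LaurentPolynomial.C (cs.klMu z u) : ℤ[T;T⁻¹]) • cs.klBasisElt z) y).coeff n =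
        if cs.length (cs.simple i * y) < cs.length y ∧ n = 0 then cs.klMu y u else 0 := by
      rw [map_sum, Finsupp.finsetSum_apply]
      have h1 : ∀ z, ((cs.heckeT laurentV).repr
          ((LaurentPolynomial.C (cs.klMu z u) : ℤ[T;T⁻¹]) • cs.klBasisElt z) y).coeff n =
          if z = y then (if n = 0 then cs.klMu y u else 0) else 0 := by
        intro z
        rw [map_smul, Finsupp.smul_apply, smul_eq_mul, ← smul_eq_C_mul,
          AddMonoidAlgebra.coeff_smul, Finsupp.smul_apply]
        change _ • (cs.klCoeff y z).coeff n = _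
        rw [klCoeff_coeff_of_nonneg _ _ _ _ hn]
        by_cases h : z = y
        · subst h; simp
        · simp [h, Ne.symm h]
      have h2 : ∀ s : Finset W, (∑ z ∈ s, (cs.heckeT laurentV).repr
          ((LaurentPolynomial.C (cs.klMu z u) : ℤ[T;T⁻¹]) • cs.klBasisElt z) y).coeff n =
          ∑ z ∈ s, if z = y then (if n = 0 then cs.klMu y u else 0) else 0 := by
        intro s
        rw [AddMonoidAlgebra.coeff_sum, Finsupp.finsetSum_apply]
        exact Finset.sum_congr rfl fun z _ => h1 z
      rw [h2, Finset.sum_ite_eq']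
      simp only [Finset.mem_filter, Finset.mem_univ, true_and]
      split_ifs <;> simp_all
    rw [map_sub, Finsupp.sub_apply, map_add, map_add, Finsupp.add_apply, Finsupp.add_apply,
      AddMonoidAlgebra.coeff_sub, Finsupp.sub_apply, AddMonoidAlgebra.coeff_add,
      AddMonoidAlgebra.coeff_add, Finsupp.add_apply, Finsupp.add_apply, hsum,
      heckeT_repr_gen_mul, map_smul, Finsupp.smul_apply, smul_eq_mul]
    simp only [klBasisElt_repr]
    have e : cs.simple i * y = u ↔ y = cs.simple i * u := by
      constructor <;> rintro rfl <;> simp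
    by_cases hy : cs.length (cs.simple i * y) < cs.length y
    · have hyu : y ≠ u := by rintro rfl; lia
      have h3 : (cs.klCoeff (cs.simple i * y) u + (((laurentV : (ℤ[T;T⁻¹])ˣ) : ℤ[T;T⁻¹]) -
          (((laurentV : (ℤ[T;T⁻¹])ˣ)⁻¹ : (ℤ[T;T⁻¹])ˣ) : ℤ[T;T⁻¹])) * cs.klCoeff y u).coeff n +
          (T (-1) * cs.klCoeff y u).coeff n =
          (cs.klCoeff (cs.simple i * y) u).coeff n + (cs.klCoeff y u).coeff (n - 1) := by
        rw [← coeff_T_mul 1 n, ← Finsupp.add_apply, ← AddMonoidAlgebra.coeff_add,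
          ← Finsupp.add_apply, ← AddMonoidAlgebra.coeff_add, val_laurentV, val_inv_laurentV]
        congr 2
        ring
      rw [if_pos hy, h3, klCoeff_coeff_of_nonneg _ _ _ _ hn, klCoeff_coeff_of_nonneg _ _ _ _ hn]
      simp only [e, hy, true_and]
      by_cases hn0 : n = 0
      · subst hn0
        rw [zero_sub, klCoeff_coeff_neg_one]; simp
      · rw [klCoeff_coeff_of_ne cs hyu _ (by lia)]; simp [hn0]
    · have h4 : y ≠ cs.simple i * u := by
        rintro rfl
        rw [simple_mul_simple_cancel_left] at hy
        exact hy hu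
      rw [if_neg hy, add_zero, coeff_T_mul, klCoeff_coeff_of_nonneg _ _ _ _ hn,
        klCoeff_coeff_of_nonneg _ _ _ _ hn, klCoeff_coeff_of_nonneg _ _ _ _ (by lia)]
      have h5 : ¬ (n + 1 = 0) := by lia
      simp [e, h4, hy, h5]

/-- If `s w < w` then `T_s C'_w = v C'_w`. -/
theorem heckeGen_mul_klBasisElt_of_gt {w : W} {i : B}
    (hw : cs.length (cs.simple i * w) < cs.length w) :
    cs.heckeGen laurentV i * cs.klBasisElt w = (T 1 : ℤ[T;T⁻¹]) • cs.klBasisElt w := by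
  classical
  induction hn : cs.length w using Nat.strong_induction_on generalizing w with
  | _ n ih =>
    -- `C'_w = C'_s C'_{s w} - ∑ μ(z, s w) C'_z`, and `T_s` multiplies each term by `v`
    have h1 := cs.heckeGen_mul_klBasisElt_of_lt_aux (u := cs.simple i * w) (i := i)
      (by rwa [simple_mul_simple_cancel_left])
    rw [simple_mul_simple_cancel_left] at h1
    rw [eq_sub_iff_add_eq.2 h1.symm, mul_sub, mul_add, ← mul_assoc, heckeGen_mul_self, smul_sub]
    congr 1
    · rw [mul_smul_comm, add_mul, one_mul, smul_add, smul_smul, ← T_add, val_laurentV,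
        val_inv_laurentV, smul_mul_assoc, sub_smul]
      simp only [add_neg_cancel, T_zero, one_smul]
      abel
    · rw [Finset.mul_sum, Finset.smul_sum]
      refine Finset.sum_congr rfl fun z hz => ?_
      rw [mul_smul_comm]
      by_cases hm : cs.klMu z (cs.simple i * w) = 0
      · simp [hm]
      · have h2 := cs.length_lt_of_klMu_ne_zero hm
        rw [ih (cs.length z) (by lia) (Finset.mem_filter.1 hz).2 rfl, smul_comm]

open Classical in
/-- If `s w < w` and `s y > y`, then `μ(y, w)` vanishes unless `w = s y`. -/
theorem klMu_of_gt {y w : W} {i : B} (hw : cs.length (cs.simple i * w) < cs.length w)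
    (hy : cs.length y < cs.length (cs.simple i * y)) :
    cs.klMu y w = if w = cs.simple i * y then 1 else 0 := by
  -- compare the coefficients of `T_{s y}` in `T_s C'_w = v C'_w`
  have h1 := congrArg (fun h => (cs.heckeT laurentV).repr h (cs.simple i * y))
    (cs.heckeGen_mul_klBasisElt_of_gt hw)
  simp only [heckeT_repr_gen_mul, simple_mul_simple_cancel_left, if_pos hy, map_smul,
    Finsupp.smul_apply, smul_eq_mul] at h1
  have h2 : cs.klCoeff y w = T (-1) * cs.klCoeff (cs.simple i * y) w := by
    rw [val_laurentV, val_inv_laurentV, sub_mul] at h1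
    change cs.klCoeff y w + (T 1 * cs.klCoeff (cs.simple i * y) w -
      T (-1) * cs.klCoeff (cs.simple i * y) w) = T 1 * cs.klCoeff (cs.simple i * y) w at h1
    linear_combination h1
  rw [← klCoeff_coeff_neg_one, h2, coeff_T_mul, klCoeff_coeff_of_nonneg _ _ _ _ (by lia)]
  simp [eq_comm]

open Classical in
theorem klMuSymm_eq {z u : W} {i : B} (hz : cs.length (cs.simple i * z) < cs.length z)
    (hu : cs.length u < cs.length (cs.simple i * u)) :
    cs.klMuSymm z u = (if z = cs.simple i * u then 1 else 0) + cs.klMu z u := by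
  rw [klMuSymm]
  split_ifs with h1 h2 h3 h4 h5
  · have := BruhatLE.length_le cs h1.1
    subst h2; lia
  · simp
  · rw [klMu_of_gt cs hz hu, if_pos h4, klMu_eq_zero_of_not_lt cs h1, add_zero]
  · rw [klMu_of_gt cs hz hu, if_neg h4, klMu_eq_zero_of_not_lt cs h1, add_zero]
  · subst h5
    exact absurd ⟨cs.bruhatLE_simple_mul i hu, fun h => by rw [← h] at hu; lia⟩ h3
  · rw [klMu_eq_zero_of_not_lt cs h1, add_zero]

open Classical in
/-- If `s u > u` then `T_s C'_u = -v⁻¹ C'_u + ∑_{s z < z} μ̃(z, u) C'_z`. -/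
theorem heckeGen_mul_klBasisElt_of_lt {u : W} {i : B}
    (hu : cs.length u < cs.length (cs.simple i * u)) :
    cs.heckeGen laurentV i * cs.klBasisElt u = -((T (-1) : ℤ[T;T⁻¹]) • cs.klBasisElt u) +
        ∑ z with cs.length (cs.simple i * z) < cs.length z,
          (LaurentPolynomial.C (cs.klMuSymm z u) : ℤ[T;T⁻¹]) • cs.klBasisElt z := by
  have h1 := cs.heckeGen_mul_klBasisElt_of_lt_aux hu
  rw [← eq_sub_iff_add_eq] at h1
  have h2 : ∑ z with cs.length (cs.simple i * z) < cs.length z,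
        (LaurentPolynomial.C (cs.klMuSymm z u) : ℤ[T;T⁻¹]) • cs.klBasisElt z =
      ∑ z with cs.length (cs.simple i * z) < cs.length z,
        ((if z = cs.simple i * u then cs.klBasisElt z else 0) +
        (LaurentPolynomial.C (cs.klMu z u) : ℤ[T;T⁻¹]) • cs.klBasisElt z) := by
    refine Finset.sum_congr rfl fun z hz => ?_
    rw [klMuSymm_eq cs (Finset.mem_filter.1 hz).2 hu, map_add, add_smul]
    split_ifs <;> simp
  rw [h1, h2, Finset.sum_add_distrib, Finset.sum_ite_eq', if_pos]
  · abel
  · exact Finset.mem_filter.2 ⟨Finset.mem_univ _, by rwa [simple_mul_simple_cancel_left]⟩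

theorem klArrow_of_klMuSymm_ne_zero {z u : W} {i : B}
    (hz : cs.length (cs.simple i * z) < cs.length z)
    (hu : cs.length u < cs.length (cs.simple i * u)) (h : cs.klMuSymm z u ≠ 0) :
    cs.KLArrow z u := by
  classical
  by_cases h1 : z = cs.simple i * u
  · exact Or.inr (Or.inr ⟨i, h1, hu⟩)
  · rw [klMuSymm_eq cs hz hu, if_neg h1, zero_add] at h
    refine Or.inr (Or.inl ⟨?_, h, i, hz, hu⟩)
    by_contra hc
    exact h (klMu_eq_zero_of_not_lt cs hc)

end KLMultiplication

/-! ### The specialised Kazhdan–Lusztig basis and the left cell representations -/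

section Specialisation

open LaurentPolynomial

variable {B W : Type*} [Group W] {M : CoxeterMatrix B} (cs : CoxeterSystem M W)
  {R : Type*} [CommRing R] (v : Rˣ)

/-- The ring homomorphism `ℤ[T, T⁻¹] → R` with `T ↦ -v⁻¹`.  It preserves the parameter
`T - T⁻¹ ↦ v - v⁻¹` of the Hecke algebra, but interchanges the eigenvalues `T`, `-T⁻¹` of the
generators. -/
noncomputable def klSpec : ℤ[T;T⁻¹] →+* R := LaurentPolynomial.eval₂ (Int.castRingHom R) (-v⁻¹)

theorem klSpec_T (n : ℤ) : klSpec v (T n) = (((-v⁻¹) ^ n : Rˣ) : R) := eval₂_T _ _ n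

theorem klSpec_T_one : klSpec v (T 1) = -((v⁻¹ : Rˣ) : R) := by simp [klSpec_T]

theorem klSpec_T_neg_one : klSpec v (T (-1)) = -(v : R) := by
  rw [klSpec_T, zpow_neg, zpow_one, inv_neg, inv_inv, Units.val_neg]

theorem klSpec_C (n : ℤ) : klSpec v (LaurentPolynomial.C n) = (n : R) := eval₂_C _ _ n

variable [Fintype W]

/-- The map `∑ a_w T_w ↦ ∑ a_w(-v⁻¹) T_w` from the generic Hecke algebra to the Hecke algebra with
parameter `v`. -/
noncomputable def heckeSpec : cs.GenericHecke →+ cs.Hecke v where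
  toFun h := ∑ y, klSpec v ((cs.heckeT laurentV).repr h y) • cs.heckeT v y
  map_zero' := by simp
  map_add' h k := by simp [add_smul, Finset.sum_add_distrib]

theorem heckeSpec_repr (h : cs.GenericHecke) (y : W) :
    (cs.heckeT v).repr (cs.heckeSpec v h) y = klSpec v ((cs.heckeT laurentV).repr h y) := by
  classical
  change (cs.heckeT v).repr (∑ y, klSpec v ((cs.heckeT laurentV).repr h y) • cs.heckeT v y) y = _
  rw [map_sum, Finsupp.finsetSum_apply]
  simp [Finsupp.single_apply]

theorem heckeSpec_smul (r : ℤ[T;T⁻¹]) (h : cs.GenericHecke) :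
    cs.heckeSpec v (r • h) = klSpec v r • cs.heckeSpec v h := by
  apply (cs.heckeT v).ext_elem
  intro y
  simp [heckeSpec_repr]

theorem heckeSpec_gen_mul (i : B) (h : cs.GenericHecke) :
    cs.heckeSpec v (cs.heckeGen laurentV i * h) = cs.heckeGen v i * cs.heckeSpec v h := by
  classical
  apply (cs.heckeT v).ext_elem
  intro y
  rw [heckeSpec_repr, heckeT_repr_gen_mul, heckeT_repr_gen_mul, heckeSpec_repr, heckeSpec_repr,
    map_add]
  congr 1
  split_ifs
  · rw [map_mul, map_sub, val_laurentV, val_inv_laurentV, klSpec_T_one, klSpec_T_neg_one]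
    ring
  · rw [map_zero]

/-- The image `C_w` of the Kazhdan–Lusztig element `C'_w` under `v ↦ -v⁻¹`; its coefficients off
the diagonal are polynomials in `v` without constant term. -/
noncomputable def klC (w : W) : cs.Hecke v := cs.heckeSpec v (cs.klBasisElt w)

theorem klC_repr (y w : W) : (cs.heckeT v).repr (cs.klC v w) y = klSpec v (cs.klCoeff y w) :=
  cs.heckeSpec_repr v _ y

theorem heckeGen_mul_klC_of_gt {w : W} {i : B}
    (hw : cs.length (cs.simple i * w) < cs.length w) :
    cs.heckeGen v i * cs.klC v w = (-((v⁻¹ : Rˣ) : R)) • cs.klC v w := by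
  rw [klC, ← heckeSpec_gen_mul, heckeGen_mul_klBasisElt_of_gt cs hw, heckeSpec_smul, klSpec_T_one]

open Classical in
theorem heckeGen_mul_klC_of_lt {u : W} {i : B}
    (hu : cs.length u < cs.length (cs.simple i * u)) :
    cs.heckeGen v i * cs.klC v u = (v : R) • cs.klC v u +
      ∑ z with cs.length (cs.simple i * z) < cs.length z,
        ((cs.klMuSymm z u : ℤ) : R) • cs.klC v z := by
  rw [klC, ← heckeSpec_gen_mul, heckeGen_mul_klBasisElt_of_lt cs hu, map_add, map_neg,
    heckeSpec_smul, klSpec_T_neg_one, map_sum, neg_smul, neg_neg]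
  congr 1
  refine Finset.sum_congr rfl fun z _ => ?_
  rw [heckeSpec_smul, klSpec_C, klC]

theorem heckeStar_klC (w : W) : cs.heckeStar v (cs.klC v w) = cs.klC v w⁻¹ := by
  apply (cs.heckeT v).ext_elem
  intro y
  rw [heckeStar_repr, klC_repr, klC_repr, ← klCoeff_inv, inv_inv]

end Specialisation

section CellRepresentation

variable {B W : Type*} [Group W] {M : CoxeterMatrix B} (cs : CoxeterSystem M W)

theorem klCoeff_eq_zero {y w : W} (hne : y ≠ w) (hl : cs.length w ≤ cs.length y) :
    cs.klCoeff y w = 0 := by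
  rw [klCoeff, (cs.isKLElement_klPoly w).repr_eq, (cs.isKLElement_klPoly w).eq_zero y, map_zero,
    mul_zero]
  intro hle
  have := (BruhatLE.eq_or_length_lt cs hle).resolve_left hne
  lia

variable {cs} in
theorem IsLeftCell.leftLE {Γ : Set W} (hΓ : cs.IsLeftCell Γ) {x y : W} (hx : x ∈ Γ) (hy : y ∈ Γ) :
    cs.LeftLE x y := by
  obtain ⟨u, rfl⟩ := hΓ
  exact Relation.ReflTransGen.trans hx.1 hy.2

variable {cs} in
theorem IsLeftCell.mem_of_leftLE {Γ : Set W} (hΓ : cs.IsLeftCell Γ) {x y z : W} (hx : x ∈ Γ)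
    (hy : y ∈ Γ) (h1 : cs.LeftLE x z) (h2 : cs.LeftLE z y) : z ∈ Γ := by
  obtain ⟨u, rfl⟩ := hΓ
  exact ⟨Relation.ReflTransGen.trans h2 hy.1, Relation.ReflTransGen.trans hx.2 h1⟩

variable [Fintype W] {K : Type*} [Field K] (v : Kˣ)

theorem span_range_klC : ⊤ ≤ Submodule.span K (Set.range (cs.klC v)) := by
  classical
  rw [← (cs.heckeT v).span_eq, Submodule.span_le]
  rintro _ ⟨w, rfl⟩
  induction hn : cs.length w using Nat.strong_induction_on generalizing w with
  | _ n ih =>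
    have h1 : cs.klC v w = cs.heckeT v w +
        ∑ y ∈ Finset.univ.erase w, klSpec v (cs.klCoeff y w) • cs.heckeT v y := by
      rw [← (cs.heckeT v).sum_repr (cs.klC v w), ← Finset.add_sum_erase _ _ (Finset.mem_univ w)]
      simp only [klC_repr, klCoeff_self, map_one, one_smul]
    rw [eq_sub_iff_add_eq.2 h1.symm]
    refine Submodule.sub_mem _ (Submodule.subset_span ⟨w, rfl⟩) (Submodule.sum_mem _ fun y hy => ?_)
    by_cases hl : cs.length w ≤ cs.length y
    · rw [klCoeff_eq_zero cs (Finset.ne_of_mem_erase hy) hl, map_zero, zero_smul]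
      exact Submodule.zero_mem _
    · exact Submodule.smul_mem _ _ (ih _ (by lia) y rfl)

/-- The elements `C_w` form a basis of the Hecke algebra. -/
noncomputable def klCBasis : Module.Basis W K (cs.Hecke v) :=
  basisOfTopLeSpanOfCardEqFinrank (cs.klC v) (cs.span_range_klC v)
    (Module.finrank_eq_card_basis (cs.heckeT v)).symm

theorem klCBasis_apply (w : W) : cs.klCBasis v w = cs.klC v w := by
  simp [klCBasis]

/-- The coefficient of `C_x` in `h C_y`. -/
noncomputable def klAct (h : cs.Hecke v) (x y : W) : K := (cs.klCBasis v).repr (h * cs.klC v y) x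

theorem mul_klC (h : cs.Hecke v) (y : W) :
    h * cs.klC v y = ∑ x, cs.klAct v h x y • cs.klC v x := by
  rw [← (cs.klCBasis v).sum_repr (h * cs.klC v y)]
  simp only [klCBasis_apply, klAct]

theorem klAct_mul (h k : cs.Hecke v) (x y : W) :
    cs.klAct v (h * k) x y = ∑ z, cs.klAct v h x z * cs.klAct v k z y := by
  rw [klAct, mul_assoc, mul_klC cs v k, Finset.mul_sum, map_sum, Finsupp.finsetSum_apply]
  refine Finset.sum_congr rfl fun z _ => ?_
  rw [mul_smul_comm, map_smul, Finsupp.smul_apply, smul_eq_mul, mul_comm]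
  rfl

theorem klAct_add (h k : cs.Hecke v) (x y : W) :
    cs.klAct v (h + k) x y = cs.klAct v h x y + cs.klAct v k x y := by
  simp [klAct, add_mul]

theorem klAct_smul (r : K) (h : cs.Hecke v) (x y : W) :
    cs.klAct v (r • h) x y = r * cs.klAct v h x y := by
  simp [klAct]

theorem klAct_zero (x y : W) : cs.klAct v 0 x y = 0 := by simp [klAct]

open Classical in
theorem klAct_one (x y : W) : cs.klAct v 1 x y = if x = y then 1 else 0 := by
  rw [klAct, one_mul, ← klCBasis_apply, Module.Basis.repr_self, Finsupp.single_apply]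
  simp only [eq_comm]

open Classical in
theorem klAct_heckeGen (i : B) (x y : W) :
    cs.klAct v (cs.heckeGen v i) x y =
      if cs.length (cs.simple i * y) < cs.length y then (if x = y then -((v⁻¹ : Kˣ) : K) else 0)
      else (if x = y then (v : K) else 0) +
        if cs.length (cs.simple i * x) < cs.length x then ((cs.klMuSymm x y : ℤ) : K) else 0 := by
  rw [klAct]
  split_ifs with h1 h2 h3 h4 h5 <;>
    first
    | rw [heckeGen_mul_klC_of_gt cs v h1]
    | rw [heckeGen_mul_klC_of_lt cs v (lt_of_le_of_ne (not_lt.1 h1)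
        (cs.length_simple_mul_ne y i).symm)]
  all_goals
    simp only [← klCBasis_apply, map_add, map_sum, map_smul, Module.Basis.repr_self,
      Finsupp.add_apply, Finsupp.finsetSum_apply, Finsupp.smul_apply, Finsupp.single_apply,
      smul_eq_mul, mul_ite, mul_one, mul_zero, Finset.sum_ite_eq', Finset.mem_filter,
      Finset.mem_univ, true_and]
    simp_all [eq_comm]

/-- The elements `C_x` with `x ≤_L y` span a left ideal. -/
theorem leftLE_of_klAct_ne_zero (h : cs.Hecke v) {x y : W} (hxy : cs.klAct v h x y ≠ 0) :
    cs.LeftLE x y := by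
  classical
  induction h using cs.hecke_gen_induction v generalizing x y with
  | one =>
    rw [klAct_one] at hxy
    rw [of_not_not fun hne => hxy (if_neg hne)]
    exact Relation.ReflTransGen.refl
  | gen i a ha =>
    rw [klAct_mul] at hxy
    obtain ⟨z, -, hz⟩ := Finset.exists_ne_zero_of_sum_ne_zero hxy
    refine Relation.ReflTransGen.head ?_ (ha (right_ne_zero_of_mul hz))
    have h1 := left_ne_zero_of_mul hz
    rw [klAct_heckeGen] at h1
    by_cases hxz : x = z
    · exact Or.inl hxz
    · simp only [hxz, if_false, zero_add] at h1
      split_ifs at h1 with h2 h3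
      · exact absurd rfl h1
      · exact klArrow_of_klMuSymm_ne_zero cs h3 (lt_of_le_of_ne (not_lt.1 h2)
          (cs.length_simple_mul_ne z i).symm) fun h0 => h1 (by rw [h0, Int.cast_zero])
      · exact absurd rfl h1
  | zero => exact absurd (klAct_zero cs v x y) hxy
  | add a b ha hb =>
    by_cases h1 : cs.klAct v a x y = 0
    · exact hb fun h2 => hxy (by rw [klAct_add, h1, h2, add_zero])
    · exact ha h1
  | smul r a ha =>
    exact ha fun h2 => hxy (by rw [klAct_smul, h2, mul_zero])

theorem klCBasis_repr_star (h : cs.Hecke v) (x : W) :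
    (cs.klCBasis v).repr (cs.heckeStar v h) x = (cs.klCBasis v).repr h x⁻¹ := by
  classical
  have : (Finsupp.lapply x).comp ((cs.klCBasis v).repr.toLinearMap.comp (cs.heckeStar v)) =
      (Finsupp.lapply x⁻¹).comp (cs.klCBasis v).repr.toLinearMap :=
    (cs.klCBasis v).ext fun w => by
      simp only [LinearMap.comp_apply, LinearEquiv.coe_coe, Finsupp.lapply_apply,
        klCBasis_apply cs v w, heckeStar_klC]
      rw [← klCBasis_apply, ← klCBasis_apply, Module.Basis.repr_self, Module.Basis.repr_self,
        Finsupp.single_apply, Finsupp.single_apply]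
      simp only [inv_eq_iff_eq_inv]
  exact LinearMap.congr_fun this h

/-- If `C_x` occurs in the product `C_y C_z` then `x ≤_R y`. -/
theorem rightLE_of_klAct_klC_ne_zero {x y z : W} (h : cs.klAct v (cs.klC v y) x z ≠ 0) :
    cs.RightLE x y := by
  refine cs.leftLE_of_klAct_ne_zero v (cs.klC v z⁻¹) ?_
  rw [klAct, ← heckeStar_klC, ← heckeStar_klC, ← heckeStar_mul, klCBasis_repr_star, inv_inv]
  exact h

open Classical in
/-- The matrix representation of the Hecke algebra carried by a left cell `Γ`: the entry at
`(x, y)` of the image of `h` is the coefficient of `C_x` in `h C_y`. -/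
noncomputable def cellMatrix {Γ : Set W} (hΓ : cs.IsLeftCell Γ) :
    cs.Hecke v →ₐ[K] Matrix Γ Γ K :=
  AlgHom.ofLinearMap
    { toFun := fun h => Matrix.of fun x y => cs.klAct v h x y
      map_add' := fun h k => by ext x y; exact klAct_add cs v h k x y
      map_smul' := fun r h => by ext x y; exact klAct_smul cs v r h x y }
    (by ext x y; simp [klAct_one, Matrix.one_apply, Subtype.ext_iff])
    (fun h k => by
      ext x y
      simp only [LinearMap.coe_mk, AddHom.coe_mk, Matrix.of_apply, Matrix.mul_apply, klAct_mul]
      symm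
      refine Fintype.sum_of_injective (Subtype.val : Γ → W) Subtype.val_injective _ _
        (fun z hz => ?_) fun z => rfl
      by_contra h0
      exact hz ⟨⟨z, hΓ.mem_of_leftLE x.2 y.2
        (cs.leftLE_of_klAct_ne_zero v h (left_ne_zero_of_mul h0))
        (cs.leftLE_of_klAct_ne_zero v k (right_ne_zero_of_mul h0))⟩, rfl⟩)

open Classical in
/-- The left cell representation `[Γ]` of the Hecke algebra. -/
noncomputable def cellRep {Γ : Set W} (hΓ : cs.IsLeftCell Γ) :
    cs.Hecke v →ₐ[K] Module.End K (Γ →₀ K) :=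
  ((Matrix.toLinAlgEquiv Finsupp.basisSingleOne : Matrix Γ Γ K ≃ₐ[K] _) : _ →ₐ[K] _).comp
    (cs.cellMatrix v hΓ)

theorem cellRep_single {Γ : Set W} (hΓ : cs.IsLeftCell Γ) (h : cs.Hecke v) (x y : Γ) :
    cs.cellRep v hΓ h (Finsupp.single y 1) x = cs.klAct v h x y := by
  classical
  have h1 : Finsupp.single y (1 : K) = Finsupp.basisSingleOne y := by simp
  rw [h1, cellRep]
  simp only [AlgHom.comp_apply, AlgEquiv.coe_toAlgHom]
  rw [Matrix.toLinAlgEquiv_self, Finsupp.finsetSum_apply,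
    Finset.sum_eq_single x (fun z _ hz => by simp [hz])
      (fun h => absurd (Finset.mem_univ x) h)]
  simp [cellMatrix]

theorem cellRep_heckeGen {Γ : Set W} (hΓ : cs.IsLeftCell Γ) (i : B) :
    cs.cellRep v hΓ (cs.heckeGen v i) = cs.leftCellOp v Γ i := by
  classical
  refine Finsupp.lhom_ext' fun y => LinearMap.ext_ring (Finsupp.ext fun x => ?_)
  simp only [LinearMap.comp_apply, Finsupp.lsingle_apply, cellRep_single, klAct_heckeGen,
    leftCellOp, Finsupp.linearCombination_single, one_smul]
  split_ifs with h1 h2 h3 h4 h4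
  · rw [Subtype.ext h2]; simp
  · rw [Finsupp.single_apply, if_neg fun h => h2 (by rw [h])]
  all_goals
    rw [finsum_eq_sum_of_fintype, Finsupp.add_apply, Finsupp.finsetSum_apply,
      Finset.sum_eq_single x (fun z _ hz => by split_ifs <;> simp [hz])
        (fun h => absurd (Finset.mem_univ x) h)]
  · rw [Subtype.ext h3] at h4
    exact absurd h4 h1
  · simp [Subtype.ext h3, h1]
  · have : y ≠ x := fun h => h3 (by rw [h])
    simp [this, h4]
  · have : y ≠ x := fun h => h3 (by rw [h])
    simp [this, h4]

end CellRepresentation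

/-! ### Representations of `W` and two-sided cells -/

section TwoSidedCells

variable {B W : Type*} [Group W] {M : CoxeterMatrix B} (cs : CoxeterSystem M W)
  {E : Type*} [AddCommGroup E] [Module ℝ E] (ρ : Representation ℝ W E)

/-- The action of the Hecke algebra at `v = 1` attached to a representation of `W`:
`T_w` acts as `w`. -/
noncomputable def heckeOneAct : cs.Hecke (1 : ℝˣ) →ₗ[ℝ] Module.End ℝ E :=
  (cs.heckeT 1).constr ℝ fun w => ρ w

theorem heckeOneAct_heckeT (w : W) : cs.heckeOneAct ρ (cs.heckeT 1 w) = ρ w :=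
  (cs.heckeT 1).constr_basis ℝ _ w

theorem heckeGen_one_mul_heckeT (i : B) (w : W) :
    cs.heckeGen (1 : ℝˣ) i * cs.heckeT 1 w = cs.heckeT 1 (cs.simple i * w) := by
  classical
  rw [heckeGen_mul_heckeT]; simp

theorem heckeOneAct_one : cs.heckeOneAct ρ 1 = 1 := by
  rw [← heckeT_one, heckeOneAct_heckeT, map_one]

theorem heckeOneAct_gen_mul (i : B) (h : cs.Hecke (1 : ℝˣ)) :
    cs.heckeOneAct ρ (cs.heckeGen 1 i * h) = ρ (cs.simple i) * cs.heckeOneAct ρ h := by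
  have : (cs.heckeOneAct ρ).comp (LinearMap.mulLeft ℝ (cs.heckeGen 1 i)) =
      (LinearMap.mulLeft ℝ (ρ (cs.simple i))).comp (cs.heckeOneAct ρ) :=
    (cs.heckeT 1).ext fun w => by
      simp [heckeGen_one_mul_heckeT, heckeOneAct_heckeT]
  exact LinearMap.congr_fun this h

theorem heckeOneAct_mul (h k : cs.Hecke (1 : ℝˣ)) :
    cs.heckeOneAct ρ (h * k) = cs.heckeOneAct ρ h * cs.heckeOneAct ρ k := by
  induction h using cs.hecke_gen_induction 1 with
  | one => rw [one_mul, heckeOneAct_one, one_mul]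
  | gen i a ha => rw [mul_assoc, heckeOneAct_gen_mul, ha, heckeOneAct_gen_mul, mul_assoc]
  | zero => simp
  | add a b ha hb => rw [add_mul, map_add, ha, hb, map_add, add_mul]
  | smul r a ha => rw [smul_mul_assoc, map_smul, ha, map_smul, smul_mul_assoc]

variable [Fintype W]

theorem map_heckeOneAct {Γ : Set W} (hΓ : cs.IsLeftCell Γ) {f : E →ₗ[ℝ] (Γ →₀ ℝ)}
    (hf : ∀ (i : B) (e : E), f (ρ (cs.simple i) e) = cs.leftCellOp (1 : ℝˣ) Γ i (f e))
    (h : cs.Hecke (1 : ℝˣ)) (e : E) :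
    f (cs.heckeOneAct ρ h e) = cs.cellRep 1 hΓ h (f e) := by
  induction h using cs.hecke_gen_induction 1 with
  | one => simp [heckeOneAct_one]
  | gen i a ha =>
    rw [heckeOneAct_gen_mul, Module.End.mul_apply, hf, ha, map_mul, Module.End.mul_apply,
      cellRep_heckeGen]
  | zero => simp
  | add a b ha hb => simp [ha, hb]
  | smul r a ha => simp [ha]

theorem cellRep_eq_zero {K : Type*} [Field K] (v : Kˣ) {Γ : Set W} (hΓ : cs.IsLeftCell Γ)
    {h : cs.Hecke v} (hh : ∀ x ∈ Γ, ∀ y ∈ Γ, cs.klAct v h x y = 0) : cs.cellRep v hΓ h = 0 := by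
  refine Finsupp.lhom_ext' fun y => LinearMap.ext_ring (Finsupp.ext fun x => ?_)
  simp only [LinearMap.comp_apply, Finsupp.lsingle_apply, cellRep_single]
  exact hh x x.2 y y.2

/-- If the irreducible representation `E` occurs in the left cell representations of `Γ` and `Γ'`,
then `Γ' ≤_{LR} Γ`. -/
theorem twoSidedLE_of_isConstituentOfLeftCell (hE : ρ.IsIrreducible) {Γ Γ' : Set W}
    (hΓ : cs.IsLeftCell Γ) (hΓ' : cs.IsLeftCell Γ') (h : cs.IsConstituentOfLeftCell ρ Γ)
    (h' : cs.IsConstituentOfLeftCell ρ Γ') {x x' : W} (hx : x ∈ Γ) (hx' : x' ∈ Γ') :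
    cs.TwoSidedLE x' x := by
  obtain ⟨f, hf0, hf⟩ := h
  obtain ⟨f', hf0', hf'⟩ := h'
  obtain ⟨e, he1, he2, -⟩ := cs.exists_selfAdjoint_complement (1 : ℝˣ)
    (fun g hg w => by
      rw [Finset.sum_eq_zero_iff_of_nonneg fun w _ => mul_self_nonneg _] at hg
      exact mul_self_eq_zero.1 (hg w (Finset.mem_univ w)))
    (LinearMap.ker (cs.heckeOneAct ρ))
    (fun h n hn => by rw [LinearMap.mem_ker] at *; rw [heckeOneAct_mul, hn, mul_zero])
    (fun h n hn => by rw [LinearMap.mem_ker] at *; rw [heckeOneAct_mul, hn, zero_mul])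
  have he : cs.heckeOneAct ρ e = 1 := by
    rw [LinearMap.mem_ker, map_sub, heckeOneAct_one, sub_eq_zero] at he1
    exact he1.symm
  -- some `C_y` in the left ideal attached to `Γ` acts nontrivially on `E`
  obtain ⟨y, hyx, hy⟩ : ∃ y, cs.LeftLE y x ∧ cs.heckeOneAct ρ (cs.klC (1 : ℝˣ) y) ≠ 0 := by
    by_contra! hc
    apply hf0
    ext1 a
    have h1 := cs.map_heckeOneAct ρ hΓ hf e a
    rw [he, Module.End.one_apply, cellRep_eq_zero cs 1 hΓ] at h1
    · rw [h1]; rfl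
    · intro z hz y hy
      rw [klAct, (he2 _ (hc y (hΓ.leftLE hy hx))).2, map_zero]; rfl
  -- hence it acts nontrivially on the left cell representation of `Γ'`
  have hinj : Function.Injective f' := by
    let U : Subrepresentation ρ := ⟨LinearMap.ker f', fun g e he => by
      rw [LinearMap.mem_ker] at *
      rw [← heckeOneAct_heckeT cs, cs.map_heckeOneAct ρ hΓ' hf', he, map_zero]⟩
    rw [← LinearMap.ker_eq_bot]
    rcases hE.eq_bot_or_eq_top U with hU | hU
    · exact congrArg Subrepresentation.toSubmodule hU
    · exact absurd (LinearMap.ker_eq_top.1 (congrArg Subrepresentation.toSubmodule hU)) hf0'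
  obtain ⟨x₁, hx₁, z, -, hz⟩ : ∃ x₁ ∈ Γ', ∃ z ∈ Γ', cs.klAct (1 : ℝˣ) (cs.klC 1 y) x₁ z ≠ 0 := by
    by_contra! hc
    apply hy
    ext1 a
    apply hinj
    rw [cs.map_heckeOneAct ρ hΓ' hf', cellRep_eq_zero cs 1 hΓ' hc]
    simp
  have h1 : cs.TwoSidedLE x' x₁ := Relation.ReflTransGen.single (Or.inl (hΓ'.leftLE hx' hx₁))
  have h2 : cs.TwoSidedLE x' y :=
    Relation.ReflTransGen.tail h1 (Or.inr (cs.rightLE_of_klAct_klC_ne_zero (1 : ℝˣ) hz))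
  exact Relation.ReflTransGen.tail h2 (Or.inl hyx)

/-- If `E` occurs in the left cell representation of the left cell of `w`, then the two-sided cell
of `w` is the one attached to `E`. -/
theorem mem_cellOf_of_isConstituentOfLeftCell (hE : ρ.IsIrreducible) (w : W)
    (h : cs.IsConstituentOfLeftCell ρ {y | cs.LeftEquiv y w}) : w ∈ cs.cellOf ρ := by
  have hw : cs.LeftEquiv w w := ⟨Relation.ReflTransGen.refl, Relation.ReflTransGen.refl⟩
  refine ⟨{y | cs.TwoSidedEquiv y w}, ⟨w, rfl⟩,
    ⟨Relation.ReflTransGen.refl, Relation.ReflTransGen.refl⟩, ⟨_, ⟨w, rfl⟩, h⟩,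
    fun Γ hΓ hc y hy => ⟨?_, ?_⟩⟩
  · exact cs.twoSidedLE_of_isConstituentOfLeftCell ρ hE ⟨w, rfl⟩ hΓ h hc hw hy
  · exact cs.twoSidedLE_of_isConstituentOfLeftCell ρ hE hΓ ⟨w, rfl⟩ hc h hy hw

end TwoSidedCells

/-! ### The valuation of `ℝ(v)` at `v = 0` -/

section Valuation

open HahnSeries LaurentSeries
open scoped RatFunc

theorem coeff_mul_self_of_le_orderTop (g : ℝ⸨X⸩) (m : ℤ) (hm : (m : WithTop ℤ) ≤ g.orderTop) :
    (g * g).coeff (m + m) = g.coeff m * g.coeff m := by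
  rcases hm.eq_or_lt with h | h
  · have hg : g ≠ 0 := by rintro rfl; simp at h
    have h1 : g.order = m := by
      rw [← WithTop.coe_eq_coe, order_eq_orderTop_of_ne_zero hg, ← h]
    have := coeff_mul_order_add_order g g
    rw [h1] at this
    rw [this, leadingCoeff_eq, h1]
  · rw [coeff_eq_zero_of_lt_orderTop h, mul_zero]
    apply coeff_eq_zero_of_lt_orderTop
    have h1 := (addVal ℤ ℝ).map_mul g g
    simp only [addVal_apply] at h1
    rw [h1, WithTop.coe_add]
    exact WithTop.add_lt_add h h

theorem orderTop_sum_mul_self_le {ι : Type*} [Fintype ι] (g : ι → ℝ⸨X⸩) (i : ι) :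
    (∑ j, g j * g j).orderTop ≤ (g i * g i).orderTop := by
  obtain ⟨i₀, -, hi₀⟩ := Finset.exists_min_image Finset.univ (fun j => (g j).orderTop)
    ⟨i, Finset.mem_univ i⟩
  have hmul : ∀ j, (g j * g j).orderTop = (g j).orderTop + (g j).orderTop := fun j => by
    simpa only [addVal_apply] using (addVal ℤ ℝ).map_mul (g j) (g j)
  refine le_trans ?_ (b := (g i₀ * g i₀).orderTop) ?_
  · by_cases h0 : g i₀ = 0
    · simp [h0]
    · have h1 := order_eq_orderTop_of_ne_zero h0
      rw [hmul, ← h1, ← WithTop.coe_add]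
      apply orderTop_le_of_coeff_ne_zero
      rw [coeff_sum, Finset.sum_congr rfl fun j _ => coeff_mul_self_of_le_orderTop (g j) _
        (h1.trans_le (hi₀ j (Finset.mem_univ j)))]
      refine (Finset.sum_pos' (fun j _ => mul_self_nonneg _) ⟨i₀, Finset.mem_univ _, ?_⟩).ne'
      exact mul_self_pos.2 (coeff_order_eq_zero.not.2 h0)
  · rw [hmul, hmul]
    exact add_le_add (hi₀ i (Finset.mem_univ i)) (hi₀ i (Finset.mem_univ i))

/-- The order of vanishing at `v = 0` on `ℝ(v)`. -/
noncomputable def ratVal : AddValuation (RatFunc ℝ) (WithTop ℤ) :=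
  (addVal ℤ ℝ).comap (algebraMap (RatFunc ℝ) ℝ⸨X⸩)

theorem ratVal_apply (f : RatFunc ℝ) : ratVal f = (algebraMap (RatFunc ℝ) ℝ⸨X⸩ f).orderTop :=
  addVal_apply

/-- As `ℝ` is formally real, no cancellation of leading terms occurs in a sum of squares. -/
theorem ratVal_sum_mul_self_le {ι : Type*} [Fintype ι] (f : ι → RatFunc ℝ) (i : ι) :
    ratVal (∑ j, f j * f j) ≤ ratVal (f i * f i) := by
  simp only [ratVal_apply, map_sum, map_mul]
  exact orderTop_sum_mul_self_le (fun j => algebraMap (RatFunc ℝ) ℝ⸨X⸩ (f j)) i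

theorem ratFunc_sum_mul_self_eq_zero {ι : Type*} [Fintype ι] (f : ι → RatFunc ℝ)
    (h : ∑ j, f j * f j = 0) (i : ι) : f i = 0 := by
  have := ratVal_sum_mul_self_le f i
  rw [h, AddValuation.map_zero, top_le_iff, AddValuation.top_iff] at this
  exact mul_self_eq_zero.1 this

theorem ratVal_X : ratVal RatFunc.X = ((1 : ℤ) : WithTop ℤ) := by
  rw [ratVal_apply, RatFunc.coe_X, orderTop_single one_ne_zero]

theorem ratVal_zpow (f : RatFunc ℝ) (n m : ℤ) (hf : ratVal f = (m : WithTop ℤ)) :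
    ratVal (f ^ n) = ((n * m : ℤ) : WithTop ℤ) := by
  have hnat : ∀ k : ℕ, ratVal (f ^ k) = ((k * m : ℤ) : WithTop ℤ) := by
    intro k
    induction k with
    | zero => simp
    | succ k ih =>
      rw [pow_succ, AddValuation.map_mul, ih, hf, ← WithTop.coe_add]
      congr 1
      push_cast; ring
  have hf0 : f ≠ 0 := by rintro rfl; simp at hf
  obtain ⟨k, rfl | rfl⟩ := n.eq_nat_or_neg
  · rw [zpow_natCast, hnat]
  · have h1 := ratVal.map_mul (f ^ k) (f ^ (-(k : ℤ)))
    rw [zpow_neg, zpow_natCast, mul_inv_cancel₀ (pow_ne_zero _ hf0), AddValuation.map_one,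
      hnat] at h1
    rw [zpow_neg, zpow_natCast]
    cases h2 : ratVal (f ^ k)⁻¹ with
    | top => rw [h2] at h1; simp at h1
    | coe a =>
      rw [h2, ← WithTop.coe_add, ← WithTop.coe_zero, WithTop.coe_eq_coe] at h1
      congr 1
      linarith

theorem algebraMap_algebraMap_laurentSeries (f : Polynomial ℝ) :
    algebraMap (RatFunc ℝ) ℝ⸨X⸩ (algebraMap (Polynomial ℝ) (RatFunc ℝ) f) =
      ofPowerSeries ℤ ℝ (f : PowerSeries ℝ) := (RatFunc.coe_coe f).symm

theorem ratVal_algebraMap (f : Polynomial ℝ) :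
    0 ≤ ratVal (algebraMap (Polynomial ℝ) (RatFunc ℝ) f) := by
  rw [ratVal_apply, le_orderTop_iff_forall]
  intro i hi
  rw [algebraMap_algebraMap_laurentSeries, PowerSeries.coeff_coe, if_pos (by exact_mod_cast hi)]

theorem coeff_zero_eq_zero_of_ratVal_pos {f : Polynomial ℝ}
    (h : 0 < ratVal (algebraMap (Polynomial ℝ) (RatFunc ℝ) f)) : f.coeff 0 = 0 := by
  rw [ratVal_apply] at h
  have h1 := coeff_eq_zero_of_lt_orderTop (Γ := ℤ) (i := 0) (by exact_mod_cast h)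
  rw [algebraMap_algebraMap_laurentSeries, PowerSeries.coeff_coe] at h1
  simpa using h1

theorem ratVal_intCast (n : ℤ) : 0 ≤ ratVal (n : RatFunc ℝ) := by
  have := ratVal_algebraMap (n : Polynomial ℝ)
  rwa [map_intCast] at this

/-- A vector is integral if its image under a matrix congruent to the identity is. -/
theorem nonneg_of_nonneg_add_sum {K ι : Type*} [Field K] [Fintype ι]
    (ν : AddValuation K (WithTop ℤ)) (u : ι → ι → K) (hu : ∀ x y, 0 < ν (u x y)) (n : ι → K)
    (hn : ∀ x, 0 ≤ ν (n x + ∑ y, u x y * n y)) (x : ι) : 0 ≤ ν (n x) := by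
  obtain ⟨x₀, -, h₀⟩ := Finset.exists_min_image Finset.univ (fun j => ν (n j))
    ⟨x, Finset.mem_univ x⟩
  refine le_trans ?_ (h₀ x (Finset.mem_univ x))
  by_contra! hneg
  have htop : ν (n x₀) ≠ ⊤ := ne_top_of_lt hneg
  have h1 : ν (n x₀) < ν (∑ y, u x₀ y * n y) := by
    refine ν.map_lt_sum htop fun y _ => ?_
    rw [AddValuation.map_mul]
    have h1 : 0 + ν (n x₀) < ν (u x₀ y) + ν (n x₀) := WithTop.add_lt_add_right htop (hu _ _)
    rw [zero_add] at h1
    exact h1.trans_le (by gcongr; exact h₀ y (Finset.mem_univ y))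
  have h2 := hn x₀
  rw [ν.map_add_eq_of_lt_left h1] at h2
  exact absurd hneg (not_lt.2 h2)

theorem withTop_nonneg_of_le_add_self {a : WithTop ℤ} (h : a ≤ a + a) : 0 ≤ a := by
  cases a with
  | top => exact le_top
  | coe a => norm_cast at h ⊢; lia

theorem withTop_nonneg_of_add_self_nonneg {a : WithTop ℤ} (h : 0 ≤ a + a) : 0 ≤ a := by
  cases a with
  | top => exact le_top
  | coe a => norm_cast at h ⊢; lia

theorem withTop_add_pos {a b : WithTop ℤ} (ha : 0 < a) (hb : 0 ≤ b) : 0 < a + b := by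
  cases a with
  | top => simp
  | coe a =>
    cases b with
    | top => simp
    | coe b => norm_cast at ha hb ⊢; lia

theorem withTop_pos_of_add_self_pos {a : WithTop ℤ} (h : 0 < a + a) : 0 < a := by
  cases a with
  | top => exact WithTop.coe_lt_top _
  | coe a => norm_cast at h ⊢; lia

end Valuation

section LeadingTerms

variable {B W : Type*} [Group W] {M : CoxeterMatrix B} (cs : CoxeterSystem M W)

theorem ratVal_neg_inv_ratV :
    ratVal ((-ratV⁻¹ : (RatFunc ℝ)ˣ) : RatFunc ℝ) = ((-1 : ℤ) : WithTop ℤ) := by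
  rw [Units.val_neg, AddValuation.map_neg, Units.val_inv_eq_inv_val, ← zpow_neg_one]
  exact (ratVal_zpow _ (-1) 1 ratVal_X).trans (by norm_num)

/-- The basis `C_w` is congruent to the basis `T_w` modulo `v`. -/
theorem ratVal_klSpec_klCoeff_pos {y w : W} (hyw : y ≠ w) :
    0 < ratVal (klSpec ratV (cs.klCoeff y w)) := by
  have h := cs.isKLElement_klPoly w
  rw [klCoeff, h.repr_eq]
  by_cases hle : cs.BruhatLE y w
  · have hl := (BruhatLE.eq_or_length_lt cs hle).resolve_left hyw
    have hdeg : (cs.klPoly y w).natDegree < cs.length w - cs.length y := by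
      by_cases h0 : cs.klPoly y w = 0
      · rw [h0, Polynomial.natDegree_zero]; lia
      · exact (Polynomial.natDegree_lt_iff_degree_lt h0).2 (h.degree_lt' cs hyw)
    rw [map_mul, klSpec_T, klSpec, LaurentPolynomial.eval₂_toLaurent,
      Polynomial.eval₂_eq_sum_range' _ hdeg, Finset.mul_sum]
    refine AddValuation.map_lt_sum _ WithTop.zero_ne_top fun k hk => ?_
    rw [Finset.mem_range] at hk
    rw [AddValuation.map_mul, AddValuation.map_mul, ← zpow_natCast, Units.val_zpow_eq_zpow_val,
      ratVal_zpow _ _ _ ratVal_neg_inv_ratV, ratVal_zpow _ _ _ ratVal_neg_inv_ratV,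
      add_left_comm, ← WithTop.coe_add]
    rw [add_comm]
    refine withTop_add_pos ?_ (ratVal_intCast _)
    norm_cast
    lia
  · rw [h.eq_zero y hle]; simp

variable [Fintype W]

/-- Let `e` be an idempotent of `H_K` whose left multiplication is self-adjoint.  If `C_w` does not
occur in `e C_w`, then all the coefficients of `e T_w` vanish at `v = 0`. -/
theorem ratVal_repr_idempotent_mul_pos {e : cs.HeckeK} (hee : e * e = e)
    (he : ∀ x y, cs.heckeForm ratV (e * x) y = cs.heckeForm ratV x (e * y)) (w : W)
    (hw : cs.klAct ratV e w w = 0) (y : W) :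
    0 < ratVal ((cs.heckeT ratV).repr (e * cs.heckeT ratV w) y) := by
  classical
  set m : W → W → RatFunc ℝ := fun x y => (cs.heckeT ratV).repr (e * cs.heckeT ratV y) x with hm
  -- the matrix of `e` is symmetric and idempotent, so that its diagonal entries are sums of squares
  have hsq : ∀ z, m z z = ∑ x, m x z * m x z := by
    intro z
    rw [← heckeForm_apply, he, ← mul_assoc, hee, heckeForm_heckeT_left]
  have hle : ∀ x z, ratVal (m z z) ≤ ratVal (m x z) + ratVal (m x z) := by
    intro x z
    conv_lhs => rw [hsq]
    rw [← AddValuation.map_mul]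
    exact ratVal_sum_mul_self_le (fun x => m x z) x
  have hint : ∀ x z, 0 ≤ ratVal (m x z) := fun x z =>
    withTop_nonneg_of_add_self_nonneg
      ((withTop_nonneg_of_le_add_self (hle z z)).trans (hle x z))
  set u : W → W → RatFunc ℝ := fun x z =>
    if x = z then 0 else klSpec ratV (cs.klCoeff x z) with hu
  have hupos : ∀ x z, 0 < ratVal (u x z) := by
    intro x z
    simp only [hu]
    split_ifs with h
    · rw [AddValuation.map_zero]; exact WithTop.coe_lt_top _
    · exact cs.ratVal_klSpec_klCoeff_pos h
  have hrepr : ∀ x z, (cs.heckeT ratV).repr (cs.klC ratV z) x =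
      (if x = z then 1 else 0) + u x z := by
    intro x z
    rw [klC_repr]
    simp only [hu]
    split_ifs with h
    · rw [h, klCoeff_self, map_one, add_zero]
    · rw [zero_add]
  -- the coordinates of `e C_w` in the basis `T_x`, computed in two ways
  have h1 : ∀ x, (cs.heckeT ratV).repr (e * cs.klC ratV w) x =
      m x w + ∑ z, u z w * m x z := by
    intro x
    have : cs.klC ratV w = ∑ z, ((if z = w then 1 else 0) + u z w) • cs.heckeT ratV z := by
      rw [← (cs.heckeT ratV).sum_repr (cs.klC ratV w)]
      simp only [hrepr]
    rw [this, Finset.mul_sum, map_sum, Finsupp.finsetSum_apply]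
    simp only [mul_smul_comm, map_smul, Finsupp.smul_apply, smul_eq_mul, add_mul,
      Finset.sum_add_distrib, ite_mul, one_mul, zero_mul, Finset.sum_ite_eq', Finset.mem_univ,
      if_true, hm]
  have h2 : ∀ x, (cs.heckeT ratV).repr (e * cs.klC ratV w) x =
      cs.klAct ratV e x w + ∑ z, u x z * cs.klAct ratV e z w := by
    intro x
    rw [mul_klC, map_sum, Finsupp.finsetSum_apply]
    simp only [map_smul, Finsupp.smul_apply, smul_eq_mul, hrepr, mul_add, mul_ite, mul_one,
      mul_zero, Finset.sum_add_distrib, Finset.sum_ite_eq, Finset.mem_univ, if_true]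
    congr 1
    exact Finset.sum_congr rfl fun z _ => mul_comm _ _
  have hs1 : ∀ x, 0 < ratVal (∑ z, u z w * m x z) := fun x =>
    AddValuation.map_lt_sum _ WithTop.zero_ne_top fun z _ => by
      rw [AddValuation.map_mul]
      exact withTop_add_pos (hupos _ _) (hint _ _)
  have hn : ∀ z, 0 ≤ ratVal (cs.klAct ratV e z w) := by
    refine nonneg_of_nonneg_add_sum ratVal u hupos _ fun x => ?_
    rw [← h2, h1]
    exact AddValuation.map_le_add _ (hint _ _) (hs1 x).le
  have hs2 : 0 < ratVal (∑ z, u w z * cs.klAct ratV e z w) :=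
    AddValuation.map_lt_sum _ WithTop.zero_ne_top fun z _ => by
      rw [AddValuation.map_mul]
      exact withTop_add_pos (hupos _ _) (hn _)
  have hww : 0 < ratVal (m w w) := by
    have h3 := (h1 w).symm.trans (h2 w)
    rw [hw, zero_add, ← eq_sub_iff_add_eq] at h3
    rw [h3]
    exact lt_of_lt_of_le (lt_min hs2 (hs1 w)) (AddValuation.map_sub _ _ _)
  exact withTop_pos_of_add_self_pos (lt_of_lt_of_le hww (hle y w))

end LeadingTerms

/-! ### Constituents of the left cell representations over `ℝ(v)` -/

/-- Let `V` be a simple module in which an element `n` can kill all `b i` only if `n e = 0`.  Then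
every module on which `e` acts nontrivially receives a nonzero map from `V`: the map `a ↦ a e m`
factors through `a ↦ (a b i)_i`, and extends to the semisimple module `V ^ ι`. -/
theorem exists_linearMap_ne_zero_of_smul_ne_zero {A V N ι : Type*} [Ring A] [AddCommGroup V]
    [Module A V] [AddCommGroup N] [Module A N] [IsSimpleModule A V] [Finite ι] (b : ι → V) (e : A)
    (he : ∀ n : A, (∀ i, n • b i = 0) → n * e = 0) (m : N) (hm : e • m ≠ 0) :
    ∃ f : V →ₗ[A] N, f ≠ 0 := by
  classical
  cases nonempty_fintype ι
  let φ : A →ₗ[A] (ι → V) := LinearMap.pi fun i => LinearMap.toSpanSingleton A V (b i)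
  let ψ : A →ₗ[A] N := LinearMap.toSpanSingleton A N (e • m)
  have hker : LinearMap.ker φ ≤ LinearMap.ker ψ := by
    intro n hn
    have h1 : n * e = 0 := he n fun i => congrFun (LinearMap.mem_ker.1 hn) i
    rw [LinearMap.mem_ker]
    change n • e • m = 0
    rw [← mul_smul, h1, zero_smul]
  obtain ⟨g, hg⟩ := IsSemisimpleModule.extension_property
    ((LinearMap.ker φ).liftQ φ le_rfl)
    (LinearMap.ker_eq_bot.1 (Submodule.ker_liftQ_eq_bot _ _ _ le_rfl))
    ((LinearMap.ker φ).liftQ ψ hker)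
  have h1 : g (φ 1) = e • m := by
    have := LinearMap.congr_fun hg (Submodule.Quotient.mk 1)
    exact this.trans (one_smul A (e • m))
  by_contra! hc
  have h2 : g = 0 := LinearMap.pi_ext' fun i => by
    rw [hc (g.comp (LinearMap.single A (fun _ => V) i)), LinearMap.zero_comp]
  exact hm (by rw [← h1, h2, LinearMap.zero_apply])

section GenericConstituents

variable {B W : Type*} [Group W] [Fintype W] {M : CoxeterMatrix B}

theorem finiteDimensional_of_isSimpleModule (cs : CoxeterSystem M W)
    (V : Type*) [AddCommGroup V] [Module (RatFunc ℝ) V] [Module cs.HeckeK V]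
    [IsScalarTower (RatFunc ℝ) cs.HeckeK V] [IsSimpleModule cs.HeckeK V] :
    FiniteDimensional (RatFunc ℝ) V := by
  have : FiniteDimensional (RatFunc ℝ) cs.HeckeK := Module.Finite.of_basis (cs.heckeT ratV)
  have : Module.Finite cs.HeckeK V := inferInstance
  exact Module.Finite.trans cs.HeckeK V

/-- For the `H_K`-module `V`: there is a self-adjoint idempotent `e` of `H_K` which acts as the
identity on `V`, and which acts as zero on every left cell module that does not contain `V`. -/
theorem exists_selfAdjoint_idempotent (cs : CoxeterSystem M W)
    (V : Type*) [AddCommGroup V] [Module (RatFunc ℝ) V] [Module cs.HeckeK V]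
    [IsScalarTower (RatFunc ℝ) cs.HeckeK V] [IsSimpleModule cs.HeckeK V] :
    ∃ e : cs.HeckeK, e * e = e ∧
    (∀ x y, cs.heckeForm ratV (e * x) y = cs.heckeForm ratV x (e * y)) ∧
    (∀ x : V, e • x = x) ∧
    ∀ (Γ : Set W) (hΓ : cs.IsLeftCell Γ), cs.cellRep ratV hΓ e ≠ 0 →
      ∃ f : V →ₗ[RatFunc ℝ] (Γ →₀ RatFunc ℝ), f ≠ 0 ∧
        ∀ (h : cs.HeckeK) (x : V), f (h • x) = cs.cellRep ratV hΓ h (f x) := by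
  have := cs.finiteDimensional_of_isSimpleModule V
  let act : cs.HeckeK →ₐ[RatFunc ℝ] Module.End (RatFunc ℝ) V :=
    Algebra.lsmul (RatFunc ℝ) (RatFunc ℝ) V
  have hact : ∀ h x, act h x = h • x := fun h x => rfl
  obtain ⟨e, he1, he2, he3⟩ := cs.exists_selfAdjoint_complement ratV
    ratFunc_sum_mul_self_eq_zero (LinearMap.ker act.toLinearMap)
    (fun h n hn => by
      rw [LinearMap.mem_ker, AlgHom.toLinearMap_apply] at *; rw [map_mul, hn, mul_zero])
    (fun h n hn => by
      rw [LinearMap.mem_ker, AlgHom.toLinearMap_apply] at *; rw [map_mul, hn, zero_mul])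
  have hee : e * e = e := by
    have := (he2 _ he1).1
    rw [sub_mul, one_mul, sub_eq_zero] at this
    exact this.symm
  refine ⟨e, hee, he3, fun x => ?_, fun Γ hΓ hne => ?_⟩
  · have h1 : act (1 - e) = 0 := he1
    have h2 := LinearMap.congr_fun h1 x
    rw [hact, sub_smul, one_smul, LinearMap.zero_apply, sub_eq_zero] at h2
    exact h2.symm
  · obtain ⟨m, hm⟩ : ∃ m, cs.cellRep ratV hΓ e m ≠ 0 := by
      by_contra! hc
      exact hne (LinearMap.ext hc)
    let : Module cs.HeckeK (Γ →₀ RatFunc ℝ) :=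
      Module.compHom _ (cs.cellRep ratV hΓ).toRingHom
    have hsm : ∀ (h : cs.HeckeK) (m : Γ →₀ RatFunc ℝ), h • m = cs.cellRep ratV hΓ h m :=
      fun h m => rfl
    let b := Module.finBasis (RatFunc ℝ) V
    obtain ⟨f, hf⟩ := exists_linearMap_ne_zero_of_smul_ne_zero (A := cs.HeckeK) b e
      (fun n hn => (he2 n (b.ext fun i => hn i)).1) m hm
    refine ⟨{ toFun := f, map_add' := f.map_add, map_smul' := fun r x => ?_ }, fun h0 => hf ?_,
      fun h x => f.map_smul h x⟩
    · have h1 := f.map_smul (algebraMap (RatFunc ℝ) cs.HeckeK r) x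
      rw [algebraMap_smul, hsm, AlgHom.commutes] at h1
      exact h1
    · ext1 x
      exact LinearMap.congr_fun h0 x

end GenericConstituents

/-! ### Lattices over `ℝ[v]` and specialisation at `v = 1` -/

section Lattice

open Polynomial

variable {A K V : Type*} [CommRing A] [Field K] [Algebra A K]
  [IsFractionRing A K] [AddCommGroup V] [Module K V] [Module A V] [IsScalarTower A K V]
  (L : Submodule A V) [Submodule.IsLattice K L]

theorem extendOfIsLattice_repr {ι : Type*} [Fintype ι] (b : Module.Basis ι A L) (x : L) (i : ι) :
    (b.extendOfIsLattice K).repr (x : V) i = algebraMap A K (b.repr x i) := by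
  have h1 : (x : V) = ∑ j, algebraMap A K (b.repr x j) • b.extendOfIsLattice K j := by
    have h2 := congrArg L.subtype (b.sum_repr x)
    rw [map_sum] at h2
    rw [← Submodule.subtype_apply, ← h2]
    exact Finset.sum_congr rfl fun j _ => by simp [algebraMap_smul]
  rw [h1, Module.Basis.repr_sum_self]

theorem trace_eq_algebraMap_trace {ι : Type*} [Fintype ι] (b : Module.Basis ι A L)
    (g : V →ₗ[K] V) (hg : ∀ x ∈ L, g x ∈ L) :
    LinearMap.trace K V g = algebraMap A K (∑ i, b.repr ⟨g (b i), hg _ (b i).2⟩ i) := by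
  classical
  rw [LinearMap.trace_eq_matrix_trace K (b.extendOfIsLattice K), Matrix.trace, map_sum]
  refine Finset.sum_congr rfl fun i _ => ?_
  rw [Matrix.diag_apply, LinearMap.toMatrix_apply, Module.Basis.extendOfIsLattice_apply]
  exact extendOfIsLattice_repr L b ⟨g (b i), hg _ (b i).2⟩ i

end Lattice

section HeckeLattice

open Polynomial

variable {B W : Type*} [Group W] {M : CoxeterMatrix B}

/-- An `ℝ[v]`-submodule which is stable under all `v T_s` is stable under all `v ^ (ℓ w) T_w`. -/
theorem pow_length_smul_mem (cs : CoxeterSystem M W)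
    {V : Type*} [AddCommGroup V] [Module (RatFunc ℝ) V] [Module cs.HeckeK V]
    [IsScalarTower (RatFunc ℝ) cs.HeckeK V] [Module ℝ[X] V] {L : Submodule ℝ[X] V}
    (hL : ∀ i, ∀ x ∈ L, (RatFunc.X : RatFunc ℝ) • cs.heckeGen ratV i • x ∈ L) (w : W) :
    ∀ x ∈ L, (RatFunc.X : RatFunc ℝ) ^ cs.length w • cs.heckeT ratV w • x ∈ L := by
  induction hn : cs.length w generalizing w with
  | zero =>
    rw [cs.length_eq_zero_iff] at hn
    intro x hx
    rwa [hn, heckeT_one, pow_zero, one_smul, one_smul]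
  | succ n ih =>
    have hw : w ≠ 1 := by rintro rfl; simp at hn
    obtain ⟨i, hi⟩ := cs.exists_leftDescent_of_ne_one hw
    have hi' : cs.length (cs.simple i * w) < cs.length w := hi
    have h1 := cs.length_simple_mul w i
    have h2 := cs.heckeGen_mul_heckeT_of_lt ratV i (cs.simple i * w)
      (by rwa [simple_mul_simple_cancel_left])
    rw [simple_mul_simple_cancel_left] at h2
    intro x hx
    have h3 := hL i _ (ih (cs.simple i * w) (by lia) x hx)
    rw [← h2, mul_smul, pow_succ', mul_smul]
    rw [smul_comm (cs.heckeGen ratV i) (_ ^ n)] at h3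
    exact h3

/-- The function `v ^ (ℓ w) trace(T_w, V)` is a polynomial in `v`. -/
theorem exists_pow_length_mul_heckeTrace [Fintype W] (cs : CoxeterSystem M W)
    (V : Type*) [AddCommGroup V] [Module (RatFunc ℝ) V] [Module cs.HeckeK V]
    [IsScalarTower (RatFunc ℝ) cs.HeckeK V] [IsSimpleModule cs.HeckeK V] (w : W) :
    ∃ f : ℝ[X], RatFunc.X ^ cs.length w * cs.heckeTrace V w = algebraMap ℝ[X] (RatFunc ℝ) f := by
  classical
  have := cs.finiteDimensional_of_isSimpleModule V
  let : Module ℝ[X] V := Module.compHom V (algebraMap ℝ[X] (RatFunc ℝ))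
  have hsm : ∀ (a : ℝ[X]) (x : V), a • x = algebraMap ℝ[X] (RatFunc ℝ) a • x := fun _ _ => rfl
  have : IsScalarTower ℝ[X] (RatFunc ℝ) V := ⟨fun a k x => by
    rw [hsm, Algebra.smul_def, mul_smul]⟩
  have : Nontrivial V := IsSimpleModule.nontrivial cs.HeckeK V
  obtain ⟨v₀, hv₀⟩ := exists_ne (0 : V)
  have hX0 : (RatFunc.X : RatFunc ℝ) ≠ 0 := RatFunc.X_ne_zero
  set t : W → V := fun w => (RatFunc.X : RatFunc ℝ) ^ cs.length w • cs.heckeT ratV w • v₀ with ht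
  set L : Submodule ℝ[X] V := Submodule.span ℝ[X] (Set.range t) with hLdef
  have hlat : Submodule.IsLattice (RatFunc ℝ) L := by
    refine ⟨Submodule.fg_span (Set.finite_range t), ?_⟩
    rw [hLdef, Submodule.span_span_of_tower, eq_top_iff]
    rintro x -
    obtain ⟨h, rfl⟩ := IsSimpleModule.toSpanSingleton_surjective cs.HeckeK hv₀ x
    rw [LinearMap.toSpanSingleton_apply, ← (cs.heckeT ratV).sum_repr h, Finset.sum_smul]
    refine Submodule.sum_mem _ fun w _ => ?_
    rw [smul_assoc]
    refine Submodule.smul_mem _ _ ?_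
    have : cs.heckeT ratV w • v₀ = ((RatFunc.X : RatFunc ℝ) ^ cs.length w)⁻¹ • t w := by
      rw [ht, inv_smul_smul₀ (pow_ne_zero _ hX0)]
    rw [this]
    exact Submodule.smul_mem _ _ (Submodule.subset_span ⟨w, rfl⟩)
  have hgen : ∀ i, ∀ x ∈ L, (RatFunc.X : RatFunc ℝ) • cs.heckeGen ratV i • x ∈ L := by
    intro i x hx
    induction hx using Submodule.span_induction with
    | mem x hx =>
      obtain ⟨w, rfl⟩ := hx
      have hlen := cs.length_simple_mul w i
      have h1 : (RatFunc.X : RatFunc ℝ) • cs.heckeGen ratV i • t w =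
          (RatFunc.X : RatFunc ℝ) ^ (cs.length w + 1) •
            (cs.heckeGen ratV i * cs.heckeT ratV w) • v₀ := by
        rw [ht, mul_smul, pow_succ', mul_smul]
        congr 1
        rw [smul_comm]
      rw [h1, heckeGen_mul_heckeT]
      split_ifs with hlt
      · have h2 : cs.length w + 1 = cs.length (cs.simple i * w) + 2 := by lia
        have h3 : (RatFunc.X : RatFunc ℝ) ^ (cs.length w + 1) *
            ((ratV : RatFunc ℝ) - ((ratV⁻¹ : (RatFunc ℝ)ˣ) : RatFunc ℝ)) =
            algebraMap ℝ[X] (RatFunc ℝ) (X ^ 2 - 1) * RatFunc.X ^ cs.length w := by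
          rw [map_sub, map_pow, map_one, RatFunc.algebraMap_X]
          simp only [ratV, Units.val_mk0, Units.val_inv_eq_inv_val]
          field_simp
          ring
        have h4 : (RatFunc.X : RatFunc ℝ) ^ (cs.length w + 1) =
            algebraMap ℝ[X] (RatFunc ℝ) (X ^ 2) * RatFunc.X ^ cs.length (cs.simple i * w) := by
          rw [map_pow, RatFunc.algebraMap_X, h2, pow_add, mul_comm]
        rw [add_smul, smul_add, smul_assoc (_ : RatFunc ℝ) (cs.heckeT ratV w) v₀, ← mul_smul, h3,
          h4, mul_smul, mul_smul, ← hsm, ← hsm]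
        exact L.add_mem (L.smul_mem _ (Submodule.subset_span ⟨_, rfl⟩))
          (L.smul_mem _ (Submodule.subset_span ⟨_, rfl⟩))
      · have h2 : cs.length w + 1 = cs.length (cs.simple i * w) := by lia
        rw [add_zero, h2]
        exact Submodule.subset_span ⟨_, rfl⟩
    | zero => simp
    | add x y _ _ hx hy => rw [smul_add, smul_add]; exact L.add_mem hx hy
    | smul a x _ hx =>
      rw [hsm, smul_comm (cs.heckeGen ratV i), smul_comm, ← hsm]
      exact L.smul_mem _ hx
  have hT := cs.pow_length_smul_mem hgen w
  let b := Module.Free.chooseBasis ℝ[X] L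
  have h1 := trace_eq_algebraMap_trace L b
    ((RatFunc.X : RatFunc ℝ) ^ cs.length w •
      Algebra.lsmul (RatFunc ℝ) (RatFunc ℝ) V (cs.heckeT ratV w)) (fun x hx => hT x hx)
  rw [map_smul, smul_eq_mul] at h1
  exact ⟨_, h1⟩

/-- The invariant `a_E` is attained: `ℓ (w₀)`, the maximal length, belongs to the set of which it is
the infimum. -/
theorem exists_pow_aInvariant_mul_heckeTrace [Fintype W] (cs : CoxeterSystem M W)
    (V : Type*) [AddCommGroup V] [Module (RatFunc ℝ) V] [Module cs.HeckeK V]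
    [IsScalarTower (RatFunc ℝ) cs.HeckeK V] [IsSimpleModule cs.HeckeK V] (w : W) :
    ∃ f : ℝ[X], RatFunc.X ^ cs.aInvariant V * cs.heckeTrace V w =
      algebraMap ℝ[X] (RatFunc ℝ) f := by
  have hne : {n : ℕ | ∀ w : W, ∃ f : ℝ[X],
      RatFunc.X ^ n * cs.heckeTrace V w = algebraMap ℝ[X] (RatFunc ℝ) f}.Nonempty := by
    refine ⟨Finset.univ.sup cs.length, fun w => ?_⟩
    obtain ⟨f, hf⟩ := cs.exists_pow_length_mul_heckeTrace V w
    refine ⟨X ^ (Finset.univ.sup cs.length - cs.length w) * f, ?_⟩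
    rw [map_mul, ← hf, map_pow, RatFunc.algebraMap_X, ← mul_assoc, ← pow_add,
      Nat.sub_add_cancel (Finset.le_sup (f := cs.length) (Finset.mem_univ w))]
  exact Nat.sInf_mem hne w

end HeckeLattice

section Specialise

open Polynomial

variable {B W : Type*} [Group W] {M : CoxeterMatrix B} (cs : CoxeterSystem M W)

theorem heckeT_one_mul_heckeT (w w' : W) :
    cs.heckeT (1 : ℝˣ) w * cs.heckeT 1 w' = cs.heckeT 1 (w * w') := by
  induction hn : cs.length w generalizing w with
  | zero =>
    rw [cs.length_eq_zero_iff] at hn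
    rw [hn, heckeT_one, one_mul, one_mul]
  | succ n ih =>
    have hw : w ≠ 1 := by rintro rfl; simp at hn
    obtain ⟨i, hi⟩ := cs.exists_leftDescent_of_ne_one hw
    have hi' : cs.length (cs.simple i * w) < cs.length w := hi
    have h1 := cs.length_simple_mul w i
    have h2 := cs.heckeGen_one_mul_heckeT i (cs.simple i * w)
    rw [simple_mul_simple_cancel_left] at h2
    rw [← h2, mul_assoc, ih _ (by lia), heckeGen_one_mul_heckeT, mul_assoc,
      simple_mul_simple_cancel_left]

variable [Fintype W]

theorem cellRep_apply {K : Type*} [Field K] (v : Kˣ) {Γ : Set W} [Fintype Γ]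
    (hΓ : cs.IsLeftCell Γ) (h : cs.Hecke v) (m : Γ →₀ K) (x : Γ) :
    cs.cellRep v hΓ h m x = ∑ y : Γ, cs.klAct v h x y * m y := by
  classical
  have hm : m = ∑ y : Γ, m y • Finsupp.single y (1 : K) := by
    ext z
    rw [Finsupp.finsetSum_apply, Finset.sum_eq_single z (fun y _ hy => by simp [hy])
      (fun h => absurd (Finset.mem_univ z) h)]
    simp
  conv_lhs => rw [hm]
  rw [map_sum, Finsupp.finsetSum_apply]
  refine Finset.sum_congr rfl fun y _ => ?_
  rw [map_smul, Finsupp.smul_apply, cellRep_single, smul_eq_mul, mul_comm]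

/-- The matrix coefficients of `v T_s` on the Kazhdan–Lusztig basis are polynomials in `v`, whose
values at `v = 1` are the coefficients for the group algebra. -/
theorem exists_poly_klAct_heckeGen (i : B) (x y : W) :
    ∃ a : ℝ[X], RatFunc.X * cs.klAct ratV (cs.heckeGen ratV i) x y =
        algebraMap ℝ[X] (RatFunc ℝ) a ∧
      a.eval 1 = cs.klAct (1 : ℝˣ) (cs.heckeGen 1 i) x y := by
  classical
  have hX0 : (RatFunc.X : RatFunc ℝ) ≠ 0 := RatFunc.X_ne_zero
  simp only [klAct_heckeGen]
  split_ifs with h1 h2 h3 h4 h4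
  · refine ⟨-1, ?_, by simp⟩
    simp only [ratV, Units.val_inv_eq_inv_val, Units.val_mk0, map_neg, map_one]
    rw [mul_neg, mul_inv_cancel₀ hX0]
  · exact ⟨0, by simp, by simp⟩
  · refine ⟨X ^ 2 + X * ((cs.klMuSymm x y : ℤ) : ℝ[X]), ?_, by simp⟩
    rw [map_add, map_mul, map_pow, map_intCast, RatFunc.algebraMap_X]
    simp only [ratV, Units.val_mk0]
    ring
  · refine ⟨X ^ 2, ?_, by simp⟩
    rw [map_pow, RatFunc.algebraMap_X]
    simp only [ratV, Units.val_mk0]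
    ring
  · refine ⟨X * ((cs.klMuSymm x y : ℤ) : ℝ[X]), ?_, by simp⟩
    rw [map_mul, map_intCast, RatFunc.algebraMap_X, zero_add]
  · exact ⟨0, by simp, by simp⟩

theorem exists_poly_klAct_heckeT (w x y : W) :
    ∃ a : ℝ[X], RatFunc.X ^ cs.length w * cs.klAct ratV (cs.heckeT ratV w) x y =
        algebraMap ℝ[X] (RatFunc ℝ) a ∧
      a.eval 1 = cs.klAct (1 : ℝˣ) (cs.heckeT 1 w) x y := by
  classical
  induction hn : cs.length w generalizing w x y with
  | zero =>
    rw [cs.length_eq_zero_iff] at hn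
    subst hn
    rw [heckeT_one, heckeT_one, klAct_one, klAct_one, pow_zero, one_mul]
    split_ifs
    · exact ⟨1, by simp, by simp⟩
    · exact ⟨0, by simp, by simp⟩
  | succ n ih =>
    have hw : w ≠ 1 := by rintro rfl; simp at hn
    obtain ⟨i, hi⟩ := cs.exists_leftDescent_of_ne_one hw
    have hi' : cs.length (cs.simple i * w) < cs.length w := hi
    have h1 := cs.length_simple_mul w i
    have h2 : ∀ {K : Type} [Field K] (v : Kˣ), cs.heckeT v w =
        cs.heckeGen v i * cs.heckeT v (cs.simple i * w) := by
      intro K _ v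
      have h2 := cs.heckeGen_mul_heckeT_of_lt v i (cs.simple i * w)
        (by rwa [simple_mul_simple_cancel_left])
      rw [simple_mul_simple_cancel_left] at h2
      exact h2.symm
    rw [h2 ratV, h2 (1 : ℝˣ), klAct_mul, klAct_mul]
    choose a ha ha' using fun z => cs.exists_poly_klAct_heckeGen i x z
    choose c hc hc' using fun z => ih (cs.simple i * w) z y (by lia)
    refine ⟨∑ z, a z * c z, ?_, ?_⟩
    · rw [map_sum, Finset.mul_sum]
      refine Finset.sum_congr rfl fun z _ => ?_
      rw [map_mul (algebraMap ℝ[X] (RatFunc ℝ)), ← ha, ← hc]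
      ring
    · rw [eval_finsetSum]
      refine Finset.sum_congr rfl fun z _ => ?_
      rw [eval_mul, ha', hc']

end Specialise

section SpecialiseConstituent

open Polynomial

theorem nontrivial_of_isIrreducible {W : Type*} [Group W] {E : Type*} [AddCommGroup E] [Module ℝ E]
    (ρ : Representation ℝ W E) (hE : ρ.IsIrreducible) : Nontrivial E := by
  by_contra hc
  rw [not_nontrivial_iff_subsingleton] at hc
  have : (⊥ : Subrepresentation ρ) = ⊤ :=
    Subrepresentation.toSubmodule_injective (Subsingleton.elim _ _)
  exact bot_ne_top this

variable {B W : Type*} [Group W] [Fintype W] {M : CoxeterMatrix B} (cs : CoxeterSystem M W)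

theorem finiteDimensional_of_isIrreducible {E : Type*} [AddCommGroup E] [Module ℝ E]
    (ρ : Representation ℝ W E) (hE : ρ.IsIrreducible) : FiniteDimensional ℝ E := by
  have := nontrivial_of_isIrreducible ρ hE
  obtain ⟨e, he⟩ := exists_ne (0 : E)
  let U : Subrepresentation ρ := ⟨Submodule.span ℝ (Set.range fun w => ρ w e), fun g x hx => by
    induction hx using Submodule.span_induction with
    | mem x hx =>
      obtain ⟨w, rfl⟩ := hx
      refine Submodule.subset_span ⟨g * w, ?_⟩
      simp
    | zero => rw [map_zero]; exact Submodule.zero_mem _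
    | add x y _ _ hx hy => rw [map_add]; exact Submodule.add_mem _ hx hy
    | smul a x _ hx => rw [map_smul]; exact Submodule.smul_mem _ _ hx⟩
  have heU : e ∈ U.toSubmodule := Submodule.subset_span ⟨1, by simp⟩
  rcases hE.eq_bot_or_eq_top U with hU | hU
  · have : U.toSubmodule = ⊥ := congrArg Subrepresentation.toSubmodule hU
    rw [this, Submodule.mem_bot] at heU
    exact absurd heU he
  · have hU' : Submodule.span ℝ (Set.range fun w => ρ w e) = ⊤ :=
      congrArg Subrepresentation.toSubmodule hU
    exact ⟨hU' ▸ Submodule.fg_span (Set.finite_range _)⟩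

/-- Two finite-dimensional real representations of `W` with the same character, the first of which
is nonzero, are linked by a nonzero intertwining map. -/
theorem exists_intertwiningMap_ne_zero {E U : Type*} [AddCommGroup E] [Module ℝ E]
    [FiniteDimensional ℝ E] [Nontrivial E] [AddCommGroup U] [Module ℝ U] [FiniteDimensional ℝ U]
    (ρ : Representation ℝ W E) (σ : Representation ℝ W U) (h : σ.character = ρ.character) :
    ∃ φ : Representation.IntertwiningMap ρ σ, φ ≠ 0 := by
  have : Invertible (Nat.card W : ℝ) := invertibleOfNonzero (by exact_mod_cast Nat.card_pos.ne')
  have h1 := Representation.card_inv_mul_sum_char_mul_char_eq_finrank ρ σ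
  have h2 := Representation.card_inv_mul_sum_char_mul_char_eq_finrank ρ ρ
  rw [h, h2, Nat.cast_inj] at h1
  by_contra! hc
  have : Subsingleton (Representation.IntertwiningMap ρ σ) :=
    ⟨fun a b => (hc a).trans (hc b).symm⟩
  rw [Module.finrank_zero_of_subsingleton (M := Representation.IntertwiningMap ρ σ),
    Module.finrank_zero_iff] at h1
  have h3 : Representation.IntertwiningMap.id ρ = 0 := Subsingleton.elim _ _
  obtain ⟨e, he⟩ := exists_ne (0 : E)
  exact he (congrArg (fun φ : Representation.IntertwiningMap ρ ρ => φ e) h3)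

/-- If `V` embeds into the left cell module `[Γ]` over `ℝ(v)`, then the vectors of `V` with
polynomial coordinates form a pure `ℝ[v]`-lattice.  In coordinates: there are polynomial vectors
`c j`, linearly independent at `v = 1`, on whose span `v ^ (ℓ w) T_w` acts by a polynomial matrix
`N w`, with the trace of `v ^ (ℓ w) T_w` on `V`. -/
theorem exists_polynomial_basis {V : Type*} [AddCommGroup V] [Module (RatFunc ℝ) V]
    [Module cs.HeckeK V] [IsScalarTower (RatFunc ℝ) cs.HeckeK V] [IsSimpleModule cs.HeckeK V]
    {Γ : Set W} [Fintype Γ]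
    (hΓ : cs.IsLeftCell Γ) (f : V →ₗ[RatFunc ℝ] (Γ →₀ RatFunc ℝ)) (hf0 : f ≠ 0)
    (hf : ∀ (h : cs.HeckeK) (x : V), f (h • x) = cs.cellRep ratV hΓ h (f x)) :
    ∃ (n : ℕ) (c : Fin n → Γ → ℝ[X]) (N : W → Fin n → Fin n → ℝ[X]),
      (∀ r : Fin n → ℝ, (∀ γ, ∑ j, r j * (c j γ).eval 1 = 0) → r = 0) ∧
      (∀ (w : W) (j : Fin n) (γ : Γ) (a : Γ → ℝ[X]), (∀ δ : Γ, RatFunc.X ^ cs.length w *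
        cs.klAct ratV (cs.heckeT ratV w) γ δ = algebraMap ℝ[X] (RatFunc ℝ) (a δ)) →
        ∑ δ, a δ * c j δ = ∑ i, N w i j * c i γ) ∧
      ∀ w, RatFunc.X ^ cs.length w * cs.heckeTrace V w =
        algebraMap ℝ[X] (RatFunc ℝ) (∑ i, N w i i) := by
  classical
  have hfd := cs.finiteDimensional_of_isSimpleModule V
  let : Module ℝ[X] V := Module.compHom V (algebraMap ℝ[X] (RatFunc ℝ))
  have hsm : ∀ (a : ℝ[X]) (x : V), a • x = algebraMap ℝ[X] (RatFunc ℝ) a • x := fun _ _ => rfl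
  have : IsScalarTower ℝ[X] (RatFunc ℝ) V := ⟨fun a k x => by
    rw [hsm, Algebra.smul_def, mul_smul]⟩
  set ι := algebraMap ℝ[X] (RatFunc ℝ) with hι
  have hιinj : Function.Injective ι := IsFractionRing.injective ℝ[X] (RatFunc ℝ)
  have hfinj : Function.Injective f := by
    let F : Submodule cs.HeckeK V :=
      { carrier := {x | f x = 0}
        add_mem' := fun {x y} hx hy => by
          rw [Set.mem_ofPred_eq] at *; rw [map_add, hx, hy, add_zero]
        zero_mem' := map_zero f
        smul_mem' := fun h x hx => by
          rw [Set.mem_ofPred_eq] at *; rw [hf, hx, map_zero] }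
    have hF : F = ⊥ := by
      refine (eq_bot_or_eq_top F).resolve_right fun hF => hf0 ?_
      ext1 x
      have : x ∈ F := hF ▸ Submodule.mem_top
      exact this
    rw [injective_iff_map_eq_zero]
    intro x hx
    have : x ∈ F := hx
    rwa [hF, Submodule.mem_bot] at this
  -- the lattice of vectors with polynomial coordinates
  let P : Submodule ℝ[X] (Γ →₀ RatFunc ℝ) :=
    LinearMap.range (Finsupp.mapRange.linearMap (α := Γ) (Algebra.linearMap ℝ[X] (RatFunc ℝ)))
  have hP : ∀ m, m ∈ P ↔ ∀ γ, ∃ a, ι a = m γ := by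
    intro m
    constructor
    · rintro ⟨a, rfl⟩ γ
      exact ⟨a γ, by simp [hι]⟩
    · intro h
      choose a ha using h
      refine ⟨Finsupp.equivFunOnFinite.symm a, Finsupp.ext fun γ => ?_⟩
      simpa using ha γ
  let L : Submodule ℝ[X] V := P.comap (f.restrictScalars ℝ[X])
  have hL : ∀ x, x ∈ L ↔ ∀ γ, ∃ a, ι a = f x γ := fun x => hP (f x)
  have hlat : Submodule.IsLattice (RatFunc ℝ) L := by
    constructor
    · have hPn : IsNoetherian ℝ[X] P := inferInstance
      refine Submodule.fg_of_fg_map_injective (f.restrictScalars ℝ[X]) hfinj ?_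
      exact Submodule.FG.of_le (Module.Finite.iff_fg.1 inferInstance) (Submodule.map_comap_le _ _)
    · rw [eq_top_iff]
      rintro x -
      obtain ⟨a, ha⟩ := IsLocalization.exist_integer_multiples_of_finite
        (nonZeroDivisors ℝ[X]) (f x)
      have ha0 : ι a ≠ 0 := by
        rw [Ne, hι, FaithfulSMul.algebraMap_eq_zero_iff]
        exact nonZeroDivisors.coe_ne_zero a
      have hx : ι a • x ∈ L := (hL _).2 fun γ => by
        obtain ⟨c, hc⟩ := ha γ
        exact ⟨c, by rw [map_smul, Finsupp.smul_apply, hι, hc, Algebra.smul_def, smul_eq_mul]⟩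
      rw [← inv_smul_smul₀ ha0 x]
      exact Submodule.smul_mem _ _ (Submodule.subset_span hx)
  have hLw : ∀ w, ∀ x ∈ L, ((RatFunc.X : RatFunc ℝ) ^ cs.length w •
      Algebra.lsmul (RatFunc ℝ) (RatFunc ℝ) V (cs.heckeT ratV w)) x ∈ L := by
    refine fun w => cs.pow_length_smul_mem (fun i x hx => ?_) w
    rw [hL] at hx ⊢
    choose c hc using hx
    intro γ
    choose a ha _ using fun δ : Γ => cs.exists_poly_klAct_heckeGen i γ δ
    refine ⟨∑ δ, a δ * c δ, ?_⟩
    rw [map_smul, hf, Finsupp.smul_apply, cellRep_apply, smul_eq_mul, Finset.mul_sum, map_sum]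
    refine Finset.sum_congr rfl fun δ _ => ?_
    rw [map_mul, hc, hι, ← ha, mul_assoc]
  let b := Module.finBasis ℝ[X] L
  choose c hc using fun j => (hL _).1 (b j).2
  -- `N w` is the matrix of `v ^ (ℓ w) T_w` on the lattice
  refine ⟨_, c, fun w i j => b.repr ⟨_, hLw w (b j) (b j).2⟩ i, ?_, ?_, fun w => ?_⟩
  · -- a lattice vector whose coordinates vanish at `v = 1` is divisible by `v - 1` in the lattice
    intro r hr
    have hdvd : ∀ γ, ∃ d : ℝ[X], ∑ j, C (r j) * c j γ = (X - C 1) * d := by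
      intro γ
      refine dvd_iff_isRoot.2 ?_
      rw [IsRoot.def, eval_finsetSum]
      simp only [eval_mul, eval_C]
      exact hr γ
    choose d hd using hdvd
    have h10 : ι (X - C 1) ≠ 0 := fun h =>
      X_sub_C_ne_zero (1 : ℝ) (hιinj (h.trans (map_zero ι).symm))
    let y : L := ∑ j, C (r j) • b j
    have hy : ∀ γ, f (y : V) γ = ι ((X - C 1) * d γ) := by
      intro γ
      rw [← hd]
      simp only [y, AddSubmonoidClass.coe_finsetSum, Submodule.coe_smul, map_sum,
        Finsupp.finsetSum_apply, hsm, map_smul, Finsupp.smul_apply, smul_eq_mul, ← hc, map_mul]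
    let z : L := ⟨(ι (X - C 1))⁻¹ • (y : V), (hL _).2 fun γ => ⟨d γ, by
      rw [map_smul, Finsupp.smul_apply, hy, map_mul, smul_eq_mul, inv_mul_cancel_left₀ h10]⟩⟩
    have hz : y = (X - C (1 : ℝ)) • z := by
      ext1
      change (y : V) = ((X - C (1 : ℝ)) : ℝ[X]) • ((ι (X - C 1))⁻¹ • (y : V))
      rw [hsm, smul_inv_smul₀ h10]
    funext j
    have h1 := congrArg (fun x : L => eval (1 : ℝ) (b.repr x j)) hz
    simp only [y, Module.Basis.repr_sum_self, map_smul, Finsupp.smul_apply, smul_eq_mul, eval_mul,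
      eval_sub, eval_X, eval_C, sub_self, zero_mul] at h1
    exact h1
  · intro w j γ a ha
    apply hιinj
    have h1 := congrArg (fun x : L => f (x : V) γ) (b.sum_repr ⟨_, hLw w (b j) (b j).2⟩)
    simp only [AddSubmonoidClass.coe_finsetSum, Submodule.coe_smul, map_sum,
      Finsupp.finsetSum_apply, hsm, map_smul, Finsupp.smul_apply, smul_eq_mul, ← hc,
      LinearMap.smul_apply, Algebra.lsmul_coe, hf, cellRep_apply, Finset.mul_sum] at h1
    rw [map_sum, map_sum]
    simp only [map_mul]
    refine Eq.trans ?_ h1.symm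
    refine Finset.sum_congr rfl fun δ _ => ?_
    rw [← ha, mul_assoc]
  · have h1 := trace_eq_algebraMap_trace L b _ (hLw w)
    rw [map_smul, smul_eq_mul] at h1
    exact h1

/-- If the left cell module `[Γ]` over `ℝ(v)` contains `E_v`, then `[Γ]_1` contains `E`. -/
theorem isConstituentOfLeftCell_of_isGenericDeformation
    {E : Type*} [AddCommGroup E] [Module ℝ E] (ρ : Representation ℝ W E) (hE : ρ.IsIrreducible)
    {V : Type*} [AddCommGroup V] [Module (RatFunc ℝ) V] [Module cs.HeckeK V]
    [IsScalarTower (RatFunc ℝ) cs.HeckeK V] (hV : cs.IsGenericDeformation V ρ) {Γ : Set W}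
    (hΓ : cs.IsLeftCell Γ) (f : V →ₗ[RatFunc ℝ] (Γ →₀ RatFunc ℝ)) (hf0 : f ≠ 0)
    (hf : ∀ (h : cs.HeckeK) (x : V), f (h • x) = cs.cellRep ratV hΓ h (f x)) :
    cs.IsConstituentOfLeftCell ρ Γ := by
  classical
  obtain ⟨hsimple, htr⟩ := hV
  have hfdE := finiteDimensional_of_isIrreducible ρ hE
  obtain ⟨n, c, N, hindep, hN, htrace⟩ := cs.exists_polynomial_basis hΓ f hf0 hf
  let g : (Fin n → ℝ) →ₗ[ℝ] (Γ →₀ ℝ) := Fintype.linearCombination ℝ fun j =>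
    Finsupp.equivFunOnFinite.symm fun γ => (c j γ).eval 1
  have hg : ∀ r γ, g r γ = ∑ j, r j * (c j γ).eval 1 := by
    intro r γ
    simp [g, Fintype.linearCombination_apply, Finsupp.finsetSum_apply]
  have hginj : Function.Injective g := by
    rw [injective_iff_map_eq_zero]
    intro r hr
    exact hindep r fun γ => by rw [← hg, hr]; rfl
  let σ₀ : W → Module.End ℝ (Fin n → ℝ) := fun w =>
    Matrix.toLin' (Matrix.of fun i j => (N w i j).eval 1)
  have hσ : ∀ w r, g (σ₀ w r) = cs.cellRep 1 hΓ (cs.heckeT 1 w) (g r) := by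
    intro w r
    ext γ
    choose a ha ha' using fun δ : Γ => cs.exists_poly_klAct_heckeT w γ δ
    rw [hg, cellRep_apply]
    simp only [σ₀, Matrix.toLin'_apply, Matrix.mulVec, dotProduct, Matrix.of_apply, ← ha', hg,
      Finset.mul_sum, Finset.sum_mul]
    rw [Finset.sum_comm, Finset.sum_comm (s := (Finset.univ : Finset Γ))]
    refine Finset.sum_congr rfl fun j _ => ?_
    have h1 := congrArg (eval 1) (hN w j γ a ha)
    simp only [eval_finsetSum, eval_mul] at h1
    calc ∑ i, (N w i j).eval 1 * r j * (c i γ).eval 1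
        = r j * ∑ i, (N w i j).eval 1 * (c i γ).eval 1 := by
          rw [Finset.mul_sum]; exact Finset.sum_congr rfl fun _ _ => by ring
      _ = ∑ δ, (a δ).eval 1 * (r j * (c j δ).eval 1) := by
          rw [← h1, Finset.mul_sum]; exact Finset.sum_congr rfl fun _ _ => by ring
  let σ : Representation ℝ W (Fin n → ℝ) :=
    { toFun := σ₀
      map_one' := by
        ext1; ext1; apply hginj
        simp [hσ, heckeT_one]
      map_mul' := fun w w' => by
        refine LinearMap.ext fun r => hginj ?_
        rw [Module.End.mul_apply, hσ, hσ, hσ, ← Module.End.mul_apply, ← map_mul,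
          heckeT_one_mul_heckeT] }
  have hchar : σ.character = ρ.character := by
    funext w
    have h2 := congrArg (RatFunc.eval (RingHom.id ℝ) 1) (htrace w)
    have hX : (RatFunc.X : RatFunc ℝ) ^ cs.length w =
        algebraMap ℝ[X] (RatFunc ℝ) (X ^ cs.length w) := by
      rw [map_pow, RatFunc.algebraMap_X]
    have hden : eval₂ (RingHom.id ℝ) 1 (cs.heckeTrace V w).denom ≠ 0 := (htr w).1
    rw [hX, RatFunc.eval_mul _ _ (by rw [RatFunc.denom_algebraMap]; simp) hden, (htr w).2,
      RatFunc.eval_algebraMap, RatFunc.eval_algebraMap] at h2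
    change LinearMap.trace ℝ (Fin n → ℝ) (σ₀ w) = LinearMap.trace ℝ E (ρ w)
    simp only [Algebra.algebraMap_self, RingHom.id_apply, eval₂_id, eval_pow, eval_X, one_pow,
      one_mul] at h2
    rw [h2, eval_finsetSum, LinearMap.trace_eq_matrix_trace ℝ (Pi.basisFun ℝ (Fin n))]
    simp [σ₀, Matrix.trace]
  have := nontrivial_of_isIrreducible ρ hE
  obtain ⟨φ, hφ⟩ := exists_intertwiningMap_ne_zero ρ σ hchar
  refine ⟨g.comp φ.toLinearMap, fun h0 => hφ ?_, fun i e => ?_⟩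
  · ext e
    have := LinearMap.congr_fun h0 e
    rw [LinearMap.comp_apply, LinearMap.zero_apply] at this
    exact congrFun (hginj (this.trans (map_zero g).symm)) _
  · rw [LinearMap.comp_apply, LinearMap.comp_apply, ← cellRep_heckeGen cs 1 hΓ, ← heckeT_simple,
      ← hσ]
    congr 1
    exact LinearMap.congr_fun (φ.isIntertwining' (cs.simple i)) e

end SpecialiseConstituent

section LeadingCoefficients

variable {B W : Type*} [Group W] [Fintype W] {M : CoxeterMatrix B} (cs : CoxeterSystem M W)

/-! ### Leading coefficients -/

/-- The leading coefficient `c_{w,E}` vanishes if some element `e` of the Hecke algebra acts as the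
identity on `E_v` while all coefficients of `e T_w` vanish at `v = 0`. -/
theorem leadingCoeff_eq_zero_of_ratVal_repr_pos
    (V : Type*) [AddCommGroup V] [Module (RatFunc ℝ) V] [Module cs.HeckeK V]
    [IsScalarTower (RatFunc ℝ) cs.HeckeK V] [IsSimpleModule cs.HeckeK V] {e : cs.HeckeK}
    (he : ∀ x : V, e • x = x) (w : W)
    (hpos : ∀ y, 0 < ratVal ((cs.heckeT ratV).repr (e * cs.heckeT ratV w) y)) :
    cs.leadingCoeff V w = 0 := by
  have htr : cs.heckeTrace V w = ∑ y, (cs.heckeT ratV).repr (e * cs.heckeT ratV w) y *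
      cs.heckeTrace V y := by
    have h1 : Algebra.lsmul (RatFunc ℝ) (RatFunc ℝ) V (cs.heckeT ratV w) =
        Algebra.lsmul (RatFunc ℝ) (RatFunc ℝ) V (e * cs.heckeT ratV w) := by
      ext x
      simp only [Algebra.lsmul_coe, mul_smul, he]
    rw [heckeTrace, h1]
    conv_lhs => rw [← (cs.heckeT ratV).sum_repr (e * cs.heckeT ratV w)]
    simp only [map_sum, map_smul, smul_eq_mul, heckeTrace]
  obtain ⟨f, hf⟩ := cs.exists_pow_aInvariant_mul_heckeTrace V w
  have hval : 0 < ratVal (algebraMap (Polynomial ℝ) (RatFunc ℝ) f) := by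
    rw [← hf, htr, Finset.mul_sum]
    refine AddValuation.map_lt_sum _ (WithTop.coe_lt_top (0 : ℤ)).ne fun y _ => ?_
    obtain ⟨g, hg⟩ := cs.exists_pow_aInvariant_mul_heckeTrace V y
    rw [mul_left_comm, hg, AddValuation.map_mul]
    exact withTop_add_pos (hpos y) (ratVal_algebraMap g)
  rw [leadingCoeff, hf, RatFunc.num_algebraMap, coeff_zero_eq_zero_of_ratVal_pos hval, mul_zero]

end LeadingCoefficients

end CoxeterSystem

theorem corollary4p2 {B W : Type*} [Group W] [Finite W] {M : CoxeterMatrix B}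
    (cs : CoxeterSystem M W)
    {E : Type*} [AddCommGroup E] [Module ℝ E] (ρ : Representation ℝ W E) (hE : ρ.IsIrreducible)
    {V : Type*} [AddCommGroup V] [Module (RatFunc ℝ) V] [Module cs.HeckeK V]
    [IsScalarTower (RatFunc ℝ) cs.HeckeK V] (hV : cs.IsGenericDeformation V ρ)
    (w : W) (hw : cs.leadingCoeff V w ≠ 0) :
    w ∈ cs.cellOf ρ := by
  cases nonempty_fintype W
  have hsimple := hV.1
  refine cs.mem_cellOf_of_isConstituentOfLeftCell ρ hE w ?_
  by_contra hc
  obtain ⟨e, hee, hadj, he, hcell⟩ := cs.exists_selfAdjoint_idempotent V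
  have hΓ : cs.IsLeftCell {y | cs.LeftEquiv y w} := ⟨w, rfl⟩
  have h0 : cs.cellRep CoxeterSystem.ratV hΓ e = 0 := by
    by_contra h0
    obtain ⟨f, hf0, hf⟩ := hcell _ hΓ h0
    exact hc (cs.isConstituentOfLeftCell_of_isGenericDeformation ρ hE hV hΓ f hf0 hf)
  have hdiag : cs.klAct CoxeterSystem.ratV e w w = 0 := by
    let w₀ : {y | cs.LeftEquiv y w} := ⟨w, Relation.ReflTransGen.refl, Relation.ReflTransGen.refl⟩
    rw [← cs.cellRep_single CoxeterSystem.ratV hΓ e w₀ w₀, h0]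
    rfl
  exact hw (cs.leadingCoeff_eq_zero_of_ratVal_repr_pos V he w
    (cs.ratVal_repr_idempotent_mul_pos hee hadj w hdiag))
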